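/- Let $X$ be a complex Banach space, let $n\ge 1$ be an integer and let $T$ be a bounded linear operator on $X$. Let $\mathbb P_n(X)$ be the set of all $n$-dimensional subspaces of $X$, with the quotient topology of the map $(x_1,\dots,x_n)\mapsto \operatorname{span}(x_1,\dots,x_n)$ defined on the linearly independent $n$-tuples in $X^n$ (equivalently, the topology for which this map is continuous and open). The operator $T$ is called strongly $n$-supercyclic if there is an $n$-dimensional subspace $L$ of $X$ such that $\dim T^k(L)=n$ for every $k\ge 0$ and $\{T^k(L):k\ge 0\}$ is dense in $\mathbb P_n(X)$. Theorem. If $T$ is strongly $n$-supercyclic, then there are closed $T$-invariant subspaces $F$ and $X_0$ of $X$ with $X=F\oplus X_0$ and $\dim F\le n$, and a real number $R\ge 0$, such that the circle $\{z\in\mathbb C:|z|=R\}$ intersects every connected component of the spectrum of $T_0:=T|_{X_0}$, regarded as an operator on $X_0$. Moreover, if $n=2$, then $F$ can be chosen so that, in addition, $T|_F$ is diagonal, that is, $F$ has a basis of eigenvectors of $T$. -/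

import Mathlib

open Topology

/-- The set of all `n`-dimensional linear subspaces of `X`.  The requirement of finite dimension
matters only for `n = 0`, since `Module.finrank` is `0` on infinite-dimensional spaces. -/
def GrassmannianSpace (n : ℕ) (X : Type*) [NormedAddCommGroup X] [NormedSpace ℂ X] : Type _ :=
  {L : Submodule ℂ X // FiniteDimensional ℂ L ∧ Module.finrank ℂ L = n}

/-- The set of linearly independent `n`-tuples of `X`, with the topology induced by the product
topology. -/
abbrev IndependentTuples (n : ℕ) (X : Type*) [NormedAddCommGroup X] [NormedSpace ℂ X] : Type _ :=
  {x : Fin n → X // LinearIndependent ℂ x}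

/-- The map that sends a linearly independent `n`-tuple to its linear span. -/
def spanTuple (n : ℕ) (X : Type*) [NormedAddCommGroup X] [NormedSpace ℂ X]
    (x : IndependentTuples n X) : GrassmannianSpace n X :=
  ⟨Submodule.span ℂ (Set.range x.1), FiniteDimensional.span_of_finite ℂ (Set.finite_range x.1), by
    simpa using finrank_span_eq_card x.2⟩

/-- The topology of the Grassmannian: the quotient topology with respect to `spanTuple`.  As
`spanTuple` is surjective, this is the only topology for which it is continuous and open; see
`isOpenQuotientMap_spanTuple`. -/
instance instTopologicalSpaceGrassmannianSpace (n : ℕ) (X : Type*) [NormedAddCommGroup X]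
    [NormedSpace ℂ X] : TopologicalSpace (GrassmannianSpace n X) :=
  TopologicalSpace.coinduced (spanTuple n X) inferInstance

theorem isOpenQuotientMap_spanTuple (n : ℕ) (X : Type*) [NormedAddCommGroup X]
    [NormedSpace ℂ X] : IsOpenQuotientMap (spanTuple n X) := by
  refine ⟨?_, continuous_coinduced_rng, ?_⟩
  · rintro ⟨L, hfin, hL⟩
    have b := Module.finBasisOfFinrankEq ℂ L hL
    refine ⟨⟨fun i => (b i : X), ?_⟩, ?_⟩
    · exact b.linearIndependent.map' L.subtype (Submodule.ker_subtype L)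
    · apply Subtype.ext
      change Submodule.span ℂ (Set.range (fun i => (b i : X))) = L
      have h : Set.range (fun i => (b i : X)) = L.subtype '' Set.range b := by
        rw [← Set.range_comp]; rfl
      rw [h, Submodule.span_image, b.span_eq, Submodule.map_top, Submodule.range_subtype]
  · intro U hU
    rw [isOpen_coinduced]
    obtain ⟨V, hV, rfl⟩ := isOpen_induced_iff.1 hU
    rw [isOpen_iff_mem_nhds]
    rintro ⟨x, hx⟩ ⟨⟨y, hy⟩, hyV, hxy⟩
    have hspan : Submodule.span ℂ (Set.range y) = Submodule.span ℂ (Set.range x) :=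
      congrArg Subtype.val hxy
    have hmem : ∀ i, ∃ a : Fin n → ℂ, ∑ j, a j • x j = y i := fun i => by
      rw [← Submodule.mem_span_range_iff_exists_fun, ← hspan]
      exact Submodule.subset_span ⟨i, rfl⟩
    choose a ha using hmem
    let g : (Fin n → X) → (Fin n → X) := fun z i => ∑ j, a i j • z j
    have hg : Continuous g := by fun_prop
    have hgx : g x = y := funext ha
    have hW : IsOpen (V ∩ {z : Fin n → X | LinearIndependent ℂ z}) :=
      hV.inter isOpen_setOfPred_linearIndependent
    have hO : IsOpen ((fun z : IndependentTuples n X => g z.1) ⁻¹'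
        (V ∩ {z : Fin n → X | LinearIndependent ℂ z})) :=
      hW.preimage (hg.comp continuous_subtype_val)
    refine Filter.mem_of_superset (hO.mem_nhds ?_) ?_
    · change g x ∈ V ∩ {z : Fin n → X | LinearIndependent ℂ z}
      rw [hgx]
      exact ⟨hyV, hy⟩
    · rintro ⟨z, hz⟩ ⟨hzV, hzI⟩
      refine ⟨⟨g z, hzI⟩, hzV, Subtype.ext ?_⟩
      change Submodule.span ℂ (Set.range (g z)) = Submodule.span ℂ (Set.range z)
      have : FiniteDimensional ℂ (Submodule.span ℂ (Set.range z)) :=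
        FiniteDimensional.span_of_finite ℂ (Set.finite_range z)
      apply Submodule.eq_of_le_of_finrank_eq
      · rw [Submodule.span_le]
        rintro _ ⟨i, rfl⟩
        exact Submodule.sum_mem _ fun j _ =>
          Submodule.smul_mem _ _ (Submodule.subset_span ⟨j, rfl⟩)
      · rw [finrank_span_eq_card hzI, finrank_span_eq_card hz]

/-- `L` is a strongly `n`-supercyclic subspace for `T`: every `T ^ k L` (in particular `L` itself)
is `n`-dimensional, and the orbit `{T ^ k L : k ≥ 0}` is dense in the Grassmannian. -/
def IsStronglySupercyclicSubspace {X : Type*} [NormedAddCommGroup X] [NormedSpace ℂ X] (n : ℕ)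
    (T : X →L[ℂ] X) (L : Submodule ℂ X) : Prop :=
  ∃ orbit : ℕ → GrassmannianSpace n X,
    (∀ k, (orbit k).1 = L.map ((T ^ k : X →L[ℂ] X) : X →ₗ[ℂ] X)) ∧ Dense (Set.range orbit)

/-- `T` is strongly `n`-supercyclic if it has a strongly `n`-supercyclic subspace. -/
def IsStronglySupercyclic {X : Type*} [NormedAddCommGroup X] [NormedSpace ℂ X] (n : ℕ)
    (T : X →L[ℂ] X) : Prop :=
  ∃ L : Submodule ℂ X, IsStronglySupercyclicSubspace n T L

/-- The endomorphism `f` of a finite-dimensional space is diagonal in some basis. -/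
def IsDiagonalOperator {V : Type*} [AddCommGroup V] [Module ℂ V] (f : V →ₗ[ℂ] V) : Prop :=
  ∃ (d : ℕ) (b : Module.Basis (Fin d) ℂ V), (LinearMap.toMatrix b b f).IsDiag

/-! Suppose the spectrum of T has nonempty open and closed parts C in |z| < r and D in |z| > r, with
Riesz projections P and Q. Then T^k is o(r^k) on the range of P and grows faster than r^k on the
range of Q. Write L = L₁ ⊕ N with L₁ = L ∩ ker Q. The images T^k L₁ stay in ker Q. For large k the
P-components of vectors in T^k N are negligible. So if T^k L is spanned by a tuple close to x, then
Q has rank at most n - dim T^k L₁ on x and P has rank at most n - dim T^k N. These bounds add up to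
at most n (`not_frequently_near_of_growth`). If the ranges of P and Q had total dimension above n,
some n-tuple would have total rank n + 1. After a perturbation its span is not in the orbit, and
density brings late iterates near it. Hence the total dimension is at most n
(`IsStronglySupercyclic.finrank_range_add_le`).

The rest is topology of the spectrum. If some circle separates two parts, take C and D of maximal
total rank for that circle; every component of the remaining spectrum meets it. Otherwise a supremum
of radii gives a circle meeting all components (`IsRieszFamily.exists_circle`). F and X₀ are the
range and the kernel of the projection for E = C ∪ D or E = ∅. For n = 2 and E nonempty, both ranks
are 1, which gives two eigenvectors.

The Riesz projections come from Gelfand theory in the bicommutant of T: an area integral of the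
resolvent has a 0-1 valued Gelfand transform, and it is then corrected to an idempotent
(`exists_riesz_idempotent`, `exists_isRieszFamily`). -/

/-! ### The Cauchy–Pompeiu formula in the plane. -/

section CauchyPompeiu

open MeasureTheory Complex

/-- Twice the Wirtinger derivative `∂/∂z̄` of a real differentiable function. -/
noncomputable def dbar (g : ℂ → ℂ) (z : ℂ) : ℂ := fderiv ℝ g z 1 + I * fderiv ℝ g z I

theorem fderiv_apply_eq_re_im (g : ℂ → ℂ) (z v : ℂ) :
    fderiv ℝ g z v = v.re * fderiv ℝ g z 1 + v.im * fderiv ℝ g z I := by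
  have hv : v = v.re • (1 : ℂ) + v.im • I := by
    simp [re_add_im]
  conv_lhs => rw [hv]
  rw [map_add, map_smul, map_smul]
  simp

/-- Rewrites `dbar` in the rotated frame u, I * u, so that for unimodular u it splits into radial
and angular derivatives. -/
theorem dbar_mul_conj (g : ℂ → ℂ) (z u : ℂ) :
    (starRingEnd ℂ u) * dbar g z = fderiv ℝ g z u + I * fderiv ℝ g z (I * u) := by
  rw [fderiv_apply_eq_re_im g z u, fderiv_apply_eq_re_im g z (I * u), dbar]
  have hu : (starRingEnd ℂ u) = u.re - u.im * I := by
    apply Complex.ext <;> simp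
  rw [hu]
  simp only [mul_re, I_re, I_im, mul_im]
  push_cast
  linear_combination (-(u.im : ℂ) * fderiv ℝ g z I) * I_sq

theorem integrableOn_Ioi_prod_Ioo_of_continuous {f : ℝ × ℝ → ℂ} (hf : Continuous f) {B a b : ℝ}
    (hB : ∀ p : ℝ × ℝ, B < p.1 → f p = 0) :
    IntegrableOn f (Set.Ioi 0 ×ˢ Set.Ioo a b) := by
  have h1 : IntegrableOn f (Set.Icc 0 B ×ˢ Set.Icc a b) :=
    hf.continuousOn.integrableOn_compact (isCompact_Icc.prod isCompact_Icc)
  refine h1.of_forall_sdiff_eq_zero (measurableSet_Ioi.prod measurableSet_Ioo) ?_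
  rintro ⟨x, y⟩ ⟨⟨hx, hy⟩, h⟩
  refine hB _ ?_
  by_contra hlt
  exact h ⟨⟨le_of_lt hx, not_lt.1 hlt⟩, ⟨hy.1.le, hy.2.le⟩⟩

theorem integral_dbar_div_self {g : ℂ → ℂ} (hg : ContDiff ℝ 1 g) (hc : HasCompactSupport g) :
    ∫ z, dbar g z / z = -(2 * Real.pi) * g 0 := by
  have hdiff : Differentiable ℝ g := hg.differentiable one_ne_zero
  have hcd : Continuous (fderiv ℝ g) := hg.continuous_fderiv one_ne_zero
  obtain ⟨B, hB⟩ : ∃ B : ℝ, ∀ z, B < ‖z‖ → z ∉ tsupport g := by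
    obtain ⟨B, hB⟩ := hc.isCompact.isBounded.exists_norm_le
    exact ⟨B, fun z hz hz' => (hB z hz').not_gt hz⟩
  let u : ℝ → ℂ := fun θ => Real.cos θ + Real.sin θ * I
  have hu : Continuous u := by fun_prop
  have hnu : ∀ θ, starRingEnd ℂ (u θ) * u θ = 1 := by
    intro θ
    apply Complex.ext
    · simp only [u, mul_re, conj_re, conj_im, add_re, add_im, ofReal_re, ofReal_im, I_re, I_im,
        mul_im, one_re]
      linear_combination Real.cos_sq_add_sin_sq θ
    · simp [u]; ring
  have hnorm : ∀ θ, ‖u θ‖ = 1 := by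
    intro θ
    have := congrArg norm (hnu θ)
    rw [norm_mul, RCLike.norm_conj, norm_one] at this
    nlinarith [norm_nonneg (u θ)]
  have hu0 : ∀ θ, u θ ≠ 0 := fun θ h => by simpa [h] using hnorm θ
  -- At z = r u(θ), A is the radial derivative of g and C is I / r times its angular derivative. The
  -- Jacobian r cancels the pole, so both are continuous up to r = 0.
  let A : ℝ × ℝ → ℂ := fun p => fderiv ℝ g (p.1 * u p.2) (u p.2)
  let C : ℝ × ℝ → ℂ := fun p => I * fderiv ℝ g (p.1 * u p.2) (I * u p.2)
  have hAc : Continuous A := by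
    have h1 : Continuous fun p : ℝ × ℝ => fderiv ℝ g (p.1 * u p.2) := hcd.comp (by fun_prop)
    exact h1.clm_apply (by fun_prop)
  have hCc : Continuous C := by
    have h1 : Continuous fun p : ℝ × ℝ => fderiv ℝ g (p.1 * u p.2) := hcd.comp (by fun_prop)
    exact continuous_const.mul (h1.clm_apply (by fun_prop))
  have hfz : ∀ p : ℝ × ℝ, max B 0 < p.1 → (p.1 : ℂ) * u p.2 ∉ tsupport g := by
    intro p hp
    apply hB
    rw [norm_mul, hnorm, mul_one, Complex.norm_real, Real.norm_eq_abs]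
    exact lt_of_lt_of_le (lt_of_le_of_lt (le_max_left _ _) hp) (le_abs_self _)
  have hf0 : ∀ p : ℝ × ℝ, max B 0 < p.1 → fderiv ℝ g (p.1 * u p.2) = 0 := by
    intro p hp
    by_contra h
    exact hfz p hp (support_fderiv_subset ℝ h)
  have hA0 : ∀ p : ℝ × ℝ, max B 0 < p.1 → A p = 0 := fun p hp => by simp [A, hf0 p hp]
  have hC0 : ∀ p : ℝ × ℝ, max B 0 < p.1 → C p = 0 := fun p hp => by simp [C, hf0 p hp]
  have hAi := integrableOn_Ioi_prod_Ioo_of_continuous hAc (a := -Real.pi) (b := Real.pi) hA0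
  have hCi := integrableOn_Ioi_prod_Ioo_of_continuous hCc (a := -Real.pi) (b := Real.pi) hC0
  have hderiv : ∀ r θ : ℝ, HasDerivAt (fun r : ℝ => g (r * u θ)) (A (r, θ)) r := by
    intro r θ
    have h1 : HasDerivAt (fun r : ℝ => (r : ℂ) * u θ) (1 * u θ) r :=
      (Complex.ofRealCLM.hasDerivAt (x := r)).mul_const (u θ)
    rw [one_mul] at h1
    exact ((hdiff _).hasFDerivAt).comp_hasDerivAt r h1
  have hderivθ : ∀ r θ : ℝ, HasDerivAt (fun θ : ℝ => g (r * u θ)) (-I * r * C (r, θ)) θ := by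
    intro r θ
    have h0 : HasDerivAt u (I * u θ) θ := by
      have := ((Real.hasDerivAt_cos θ).ofReal_comp).add
        (((Real.hasDerivAt_sin θ).ofReal_comp).mul_const I)
      refine this.congr_deriv ?_
      change _ = I * ((Real.cos θ : ℂ) + Real.sin θ * I)
      push_cast
      linear_combination (-Complex.sin θ) * I_sq
    have h1 : HasDerivAt (fun θ : ℝ => (r : ℂ) * u θ) (r * (I * u θ)) θ := h0.const_mul _
    have h2 := ((hdiff (r * u θ)).hasFDerivAt).comp_hasDerivAt θ h1
    refine h2.congr_deriv ?_
    have h3 : (r : ℂ) * (I * u θ) = r • (I * u θ) := by simp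
    rw [h3, map_smul]
    simp only [C, Complex.real_smul]
    linear_combination ((r : ℂ) * fderiv ℝ g (r * u θ) (I * u θ)) * I_sq
  rw [← Complex.integral_comp_polarCoord_symm]
  have hpt : polarCoord.target = Set.Ioi (0 : ℝ) ×ˢ Set.Ioo (-Real.pi) Real.pi := rfl
  have hcongr : ∫ p in polarCoord.target, p.1 • (dbar g (Complex.polarCoord.symm p) /
      Complex.polarCoord.symm p) = ∫ p in Set.Ioi (0 : ℝ) ×ˢ Set.Ioo (-Real.pi) Real.pi,
        (A p + C p) := by
    rw [hpt]
    refine setIntegral_congr_fun (measurableSet_Ioi.prod measurableSet_Ioo) ?_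
    rintro ⟨r, θ⟩ ⟨hr, -⟩
    have hr' : (r : ℂ) ≠ 0 := by exact_mod_cast ne_of_gt hr
    have hpa : Complex.polarCoord.symm (r, θ) = r * u θ := Complex.polarCoord_symm_apply _
    simp only [hpa, A, C]
    rw [← dbar_mul_conj, Complex.real_smul]
    have := hu0 θ
    field_simp
    linear_combination (-dbar g (r * u θ)) * hnu θ
  rw [hcongr, integral_add hAi hCi]
  -- For fixed r this integrates an angular derivative over a full period.
  have hIC : ∫ p in Set.Ioi (0 : ℝ) ×ˢ Set.Ioo (-Real.pi) Real.pi, C p = 0 := by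
    rw [Measure.volume_eq_prod, setIntegral_prod _ hCi]
    refine integral_eq_zero_of_ae ?_
    filter_upwards [ae_restrict_mem measurableSet_Ioi] with r hr
    have hr' : (r : ℂ) ≠ 0 := by exact_mod_cast ne_of_gt hr
    have h1 : ∫ θ in (-Real.pi)..Real.pi, -I * r * C (r, θ) = 0 := by
      rw [intervalIntegral.integral_eq_sub_of_hasDerivAt (fun θ _ => hderivθ r θ)
        (Continuous.intervalIntegrable (by fun_prop) _ _)]
      simp [u]
    rw [intervalIntegral.integral_const_mul, intervalIntegral.integral_of_le
      (by linarith [Real.pi_pos]), integral_Ioc_eq_integral_Ioo] at h1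
    simpa [hr', I_ne_zero] using h1
  -- On each ray the fundamental theorem of calculus leaves only the value at the origin.
  have hIA : ∫ p in Set.Ioi (0 : ℝ) ×ˢ Set.Ioo (-Real.pi) Real.pi, A p =
      -(2 * Real.pi) * g 0 := by
    have hsw : IntegrableOn (fun q : ℝ × ℝ => A q.swap)
        (Set.Ioo (-Real.pi) Real.pi ×ˢ Set.Ioi 0) (volume.prod volume) := hAi.swap
    rw [Measure.volume_eq_prod, ← setIntegral_prod_swap, setIntegral_prod _ hsw]
    have h1 : ∀ θ : ℝ, ∫ r in Set.Ioi (0 : ℝ), A (r, θ) = -g 0 := by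
      intro θ
      have h2 : deriv (fun r : ℝ => g (r * u θ)) = fun r => A (r, θ) :=
        funext fun r => (hderiv r θ).deriv
      rw [← h2, HasCompactSupport.integral_Ioi_deriv_eq]
      · simp
      · exact hg.comp (Complex.ofRealCLM.contDiff.mul contDiff_const)
      · refine HasCompactSupport.intro (isCompact_Icc (a := -max B 0) (b := max B 0)) ?_
        intro r hr
        apply image_eq_zero_of_notMem_tsupport
        apply hB
        rw [norm_mul, hnorm, mul_one, Complex.norm_real, Real.norm_eq_abs]
        by_contra hlt
        exact hr (abs_le.1 ((not_lt.1 hlt).trans (le_max_left _ _)))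
    simp only [Prod.swap_prod_mk, h1]
    simp [Real.pi_pos.le]
    left; ring
  rw [hIA, hIC, add_zero]

theorem dbar_comp_add_right (g : ℂ → ℂ) (w z : ℂ) :
    dbar (fun z => g (z + w)) z = dbar g (z + w) := by
  simp only [dbar, fderiv_comp_add_right]

/-- The Cauchy–Pompeiu formula for compactly supported functions. -/
theorem integral_dbar_div_sub {g : ℂ → ℂ} (hg : ContDiff ℝ 1 g) (hc : HasCompactSupport g)
    (w : ℂ) : ∫ z, dbar g z / (z - w) = -(2 * Real.pi) * g w := by
  have h := integral_dbar_div_self (g := fun z => g (z + w)) (hg.comp (by fun_prop))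
    (hc.comp_homeomorph (Homeomorph.addRight w))
  rw [zero_add] at h
  rw [← h, ← integral_add_right_eq_self _ w]
  simp only [dbar_comp_add_right, add_sub_cancel_right]

end CauchyPompeiu

/-! ### Cutoff functions and growth estimates. -/

/-- Constancy on neighbourhoods, not just on the two sets, is what makes `dbar χ` vanish near the
spectrum, where the resolvent is not controlled. -/
theorem exists_contDiff_cutoff {K₁ K₂ : Set ℂ} (h₁ : IsCompact K₁) (h₂ : IsClosed K₂)
    (hd : Disjoint K₁ K₂) : ∃ χ : ℂ → ℂ, ContDiff ℝ 1 χ ∧ HasCompactSupport χ ∧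
      (∀ z ∈ K₁, χ =ᶠ[𝓝 z] fun _ => 1) ∧ (∀ z ∈ K₂, χ =ᶠ[𝓝 z] fun _ => 0) := by
  obtain ⟨L, hL, hK₁L, hLK₂⟩ := exists_compact_between h₁ h₂.isOpen_compl
    (Set.subset_compl_iff_disjoint_right.2 hd)
  obtain ⟨f, hf1, hf0, -⟩ := exists_contMDiffMap_one_nhds_of_subset_interior (n := 1)
    (modelWithCornersSelf ℝ ℂ) h₁.isClosed hK₁L
  refine ⟨fun z => (f z : ℂ), ?_, ?_, ?_, ?_⟩
  · exact Complex.ofRealCLM.contDiff.comp (contMDiff_iff_contDiff.1 f.contMDiff)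
  · exact HasCompactSupport.intro hL fun z hz => by simp [hf0 z hz]
  · intro z hz
    filter_upwards [Filter.Eventually.filter_mono (nhds_le_nhdsSet hz) hf1] with w hw
    simp [hw]
  · intro z hz
    filter_upwards [hL.isClosed.isOpen_compl.mem_nhds fun hzL => hLK₂ hzL hz] with w hw
    simp [hf0 w hw]

theorem dbar_eventuallyEq_zero {χ : ℂ → ℂ} {z c : ℂ} (h : χ =ᶠ[𝓝 z] fun _ => c) :
    dbar χ =ᶠ[𝓝 z] fun _ => 0 := by
  filter_upwards [h.eventually_nhds] with w hw
  have hw' : fderiv ℝ χ w = 0 := by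
    rw [Filter.EventuallyEq.fderiv_eq hw]; simp
  simp [dbar, hw']

/-- Gelfand's formula, with a gap q < R because the spectral radius is attained. -/
theorem exists_norm_pow_le_of_spectrum_lt {A : Type*} [NormedRing A] [NormedAlgebra ℂ A]
    [CompleteSpace A] [Nontrivial A] (a : A) {R : ℝ} (hR : ∀ z ∈ spectrum ℂ a, ‖z‖ < R) :
    ∃ q : ℝ, 0 ≤ q ∧ q < R ∧ ∀ᶠ n : ℕ in Filter.atTop, ‖a ^ n‖ ≤ q ^ n := by
  have hR0 : 0 ≤ R := by
    obtain ⟨z, hz⟩ := spectrum.nonempty a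
    exact (norm_nonneg z).trans (hR z hz).le
  lift R to NNReal using hR0
  have h := spectrum.spectralRadius_lt_of_forall_lt a (r := R)
    fun z hz => by exact_mod_cast hR z hz
  obtain ⟨q, hq, hqR⟩ := ENNReal.lt_iff_exists_nnreal_btwn.1 h
  refine ⟨q, q.2, by exact_mod_cast hqR, ?_⟩
  filter_upwards [(spectrum.pow_norm_pow_one_div_tendsto_nhds_spectralRadius a).eventually_lt_const
    hq, Filter.eventually_ge_atTop 1] with n hn hn1
  have h1 : ‖a ^ n‖ ^ (1 / n : ℝ) ≤ q := by
    have := hn.le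
    rw [← ENNReal.ofReal_coe_nnreal] at this
    exact (ENNReal.ofReal_le_ofReal_iff q.2).1 this
  have hn0 : (n : ℝ) ≠ 0 := by exact_mod_cast (by omega : n ≠ 0)
  calc ‖a ^ n‖ = (‖a ^ n‖ ^ (1 / n : ℝ)) ^ n := by
        rw [← Real.rpow_natCast, ← Real.rpow_mul (norm_nonneg _), one_div_mul_cancel hn0,
          Real.rpow_one]
    _ ≤ q ^ n := pow_le_pow_left₀ (by positivity) h1 n

theorem catalan_le_four_pow (n : ℕ) : catalan n ≤ 4 ^ n := by
  rw [catalan_eq_centralBinom_div]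
  exact (Nat.div_le_self _ _).trans n.centralBinom_le_four_pow

/-! ### Idempotents in commutative Banach algebras via Gelfand theory. -/

section Commutative

open WeakDual MeasureTheory

theorem character_resolvent {A : Type*} [NormedCommRing A] [NormedAlgebra ℂ A] {a : A} {z : ℂ}
    (hz : z ∈ resolventSet ℂ a)
    (φ : characterSpace ℂ A) : φ (resolvent a z) = (z - φ a)⁻¹ := by
  have h : (algebraMap ℂ A z - a) * resolvent a z = 1 := Ring.mul_inverse_cancel _ hz
  have h' := congrArg φ h
  rw [map_mul, map_sub, map_one, AlgHomClass.commutes] at h'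
  exact eq_inv_of_mul_eq_one_right h'

variable {A : Type*} [NormedCommRing A] [NormedAlgebra ℂ A] [CompleteSpace A]

/-- A topologically nilpotent element `s` is of the form `h - h ^ 2`, by means of the generating
function of the Catalan numbers. -/
theorem exists_sub_sq_eq_of_character_eq_zero [Nontrivial A] {s : A}
    (hs : ∀ φ : characterSpace ℂ A, φ s = 0) :
    ∃ h : A, h - h ^ 2 = s ∧ ∀ φ : characterSpace ℂ A, φ h = 0 := by
  -- The Catalan numbers grow at most like 4 ^ n, so the bound 1 / 8 makes the series converge with
  -- ratio 1 / 2.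
  obtain ⟨q, hq0, hq8, hq⟩ := exists_norm_pow_le_of_spectrum_lt s (R := 1 / 8) (by
    intro z hz
    obtain ⟨φ, rfl⟩ := CharacterSpace.mem_spectrum_iff_exists.1 hz
    simp [hs])
  let f : ℕ → A := fun n => (catalan n : ℂ) • s ^ n
  have hf : Summable fun n => ‖f n‖ := by
    refine summable_of_isBigO_nat summable_geometric_two (Asymptotics.IsBigO.of_bound 1 ?_)
    filter_upwards [hq] with n hn
    rw [norm_norm, norm_smul, Complex.norm_natCast, one_mul, Real.norm_of_nonneg (by positivity)]
    calc (catalan n : ℝ) * ‖s ^ n‖ ≤ 4 ^ n * (1 / 8) ^ n := by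
          gcongr
          · exact_mod_cast catalan_le_four_pow n
          · exact hn.trans (by gcongr)
      _ = (1 / 2) ^ n := by rw [← mul_pow]; norm_num
  -- The Catalan recursion says that the sum c satisfies c = 1 + s c², so h = s c solves h - h² = s.
  have hc : ∑' n, f n = 1 + s * (∑' n, f n) ^ 2 := by
    have h1 := hf.of_norm.tsum_eq_zero_add
    rw [sq, tsum_mul_tsum_eq_tsum_sum_antidiagonal_of_summable_norm hf hf]
    rw [← (summable_norm_sum_mul_antidiagonal_of_summable_norm hf hf).of_norm.tsum_mul_left]
    conv_lhs => rw [h1]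
    congr 1
    · simp [f]
    · refine tsum_congr fun n => ?_
      simp only [f]
      rw [catalan_succ', Nat.cast_sum, Finset.sum_smul, Finset.mul_sum]
      refine Finset.sum_congr rfl fun ij hij => ?_
      rw [Nat.cast_mul, smul_mul_smul_comm, ← pow_add, Finset.HasAntidiagonal.mem_antidiagonal.1 hij,
        mul_smul_comm, pow_succ']
  refine ⟨s * ∑' n, f n, ?_, fun φ => by rw [map_mul, hs, zero_mul]⟩
  linear_combination s * hc

theorem isUnit_of_character_ne_zero {a : A} (h : ∀ φ : characterSpace ℂ A, φ a ≠ 0) :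
    IsUnit a := by
  by_contra hn
  obtain ⟨φ, hφ⟩ := CharacterSpace.exists_apply_eq_zero hn
  exact h φ hφ

/-- The element 1 - g is invertible and annihilates g. -/
theorem eq_zero_of_isIdempotentElem_of_character_eq_zero {g : A} (hg : IsIdempotentElem g)
    (h : ∀ φ : characterSpace ℂ A, φ g = 0) : g = 0 := by
  have hu : IsUnit (1 - g) := isUnit_of_character_ne_zero fun φ => by simp [h]
  refine hu.mul_left_cancel ?_
  rw [mul_zero, sub_mul, one_mul, hg.eq, sub_self]

/-- Both e (1 - f) and f (1 - e) are idempotents with zero Gelfand transform, hence vanish.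
Identities between Riesz idempotents can thus be checked on characters. -/
theorem eq_of_isIdempotentElem_of_character_eq {e f : A} (he : IsIdempotentElem e)
    (hf : IsIdempotentElem f) (h : ∀ φ : characterSpace ℂ A, φ e = φ f) : e = f := by
  have hφ : ∀ φ : characterSpace ℂ A, φ e * φ e = φ e := fun φ => by rw [← map_mul, he.eq]
  have h1 : e * (1 - f) = 0 := eq_zero_of_isIdempotentElem_of_character_eq_zero
    (he.mul hf.one_sub) fun φ => by
      rw [map_mul, map_sub, map_one, ← h]; linear_combination -hφ φ
  have h2 : f * (1 - e) = 0 := eq_zero_of_isIdempotentElem_of_character_eq_zero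
    (hf.mul he.one_sub) fun φ => by
      rw [map_mul, map_sub, map_one, ← h]; linear_combination -hφ φ
  linear_combination h1 - h2

/-- An element whose Gelfand transform is idempotent lifts to an idempotent with the same
Gelfand transform. -/
theorem exists_isIdempotentElem_character_eq [Nontrivial A] {p : A}
    (hp : ∀ φ : characterSpace ℂ A, φ p * φ p = φ p) :
    ∃ e : A, IsIdempotentElem e ∧ ∀ φ : characterSpace ℂ A, φ e = φ p := by
  -- Let d = p - p². For e = p + (1 - 2p) h one has e - e² = d + (1 - 4d)(h - h²), so h - h² must be
  -- -d / (1 - 4d), whose Gelfand transform is zero.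
  have hu : IsUnit (1 - 4 * (p - p * p)) := isUnit_of_character_ne_zero fun φ => by
    simp [hp]
  obtain ⟨v, hv⟩ := hu.exists_right_inv
  obtain ⟨h, hh, hφ⟩ := exists_sub_sq_eq_of_character_eq_zero (s := -(p - p * p) * v)
    fun φ => by simp [hp]
  refine ⟨p + (1 - 2 * p) * h, ?_, fun φ => by simp [hφ]⟩
  rw [IsIdempotentElem]
  linear_combination -(1 - 4 * (p - p * p)) * hh + (p - p * p) * hv

/-- The Riesz idempotent of a closed and open part `C` of the spectrum. -/
theorem exists_riesz_idempotent [Nontrivial A] (a : A) {C : Set ℂ} (hC : IsCompact C)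
    (hC' : IsClosed (spectrum ℂ a \ C)) :
    ∃ e : A, IsIdempotentElem e ∧ ∀ φ : characterSpace ℂ A,
      (φ a ∈ C → φ e = 1) ∧ (φ a ∉ C → φ e = 0) := by
  obtain ⟨χ, hχ, hχc, hχ1, hχ0⟩ := exists_contDiff_cutoff hC hC' Set.disjoint_sdiff_right
  have hdc : Continuous (dbar χ) := by
    have h := hχ.continuous_fderiv one_ne_zero
    unfold dbar
    fun_prop
  have hloc : ∀ z ∈ spectrum ℂ a, dbar χ =ᶠ[𝓝 z] fun _ => 0 := by
    intro z hz
    by_cases hzC : z ∈ C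
    · exact dbar_eventuallyEq_zero (hχ1 z hzC)
    · exact dbar_eventuallyEq_zero (hχ0 z ⟨hz, hzC⟩)
  -- An area integral replaces the Riesz contour integral: `dbar χ` vanishes near the spectrum, so F
  -- is continuous everywhere, and Cauchy–Pompeiu evaluates the characters of its integral.
  let F : ℂ → A := fun z => dbar χ z • resolvent a z
  have hFc : Continuous F := by
    rw [continuous_iff_continuousAt]
    intro z
    by_cases hz : z ∈ spectrum ℂ a
    · have h0 : F =ᶠ[𝓝 z] fun _ => 0 := by
        filter_upwards [hloc z hz] with w hw
        simp [F, hw]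
      exact continuousAt_const.congr h0.symm
    · exact hdc.continuousAt.smul
        (spectrum.hasDerivAt_resolvent_const_left (not_not.1 hz)).continuousAt
  have hFs : HasCompactSupport F := by
    refine HasCompactSupport.intro hχc.isCompact fun z hz => ?_
    have : fderiv ℝ χ z = 0 := by
      by_contra h
      exact hz (support_fderiv_subset ℝ h)
    simp [F, dbar, this]
  have hFi : Integrable F := hFc.integrable_of_hasCompactSupport hFs
  have hp : ∀ φ : characterSpace ℂ A,
      φ ((-(1 / (2 * Real.pi) : ℂ)) • ∫ z, F z) = χ (φ a) := by
    intro φ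
    have h1 : φ (∫ z, F z) = ∫ z, φ (F z) :=
      ((CharacterSpace.toCLM φ).integral_comp_comm hFi).symm
    have h2 : ∀ z, φ (F z) = dbar χ z / (z - φ a) := by
      intro z
      by_cases hz : z ∈ spectrum ℂ a
      · simp [F, (hloc z hz).self_of_nhds]
      · simp only [F]
        rw [map_smul, character_resolvent (not_not.1 hz), smul_eq_mul, div_eq_mul_inv]
    rw [map_smul, h1]
    simp only [h2]
    rw [integral_dbar_div_sub hχ hχc, smul_eq_mul]
    have : (Real.pi : ℂ) ≠ 0 := by exact_mod_cast Real.pi_ne_zero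
    field_simp
  have hval : ∀ φ : characterSpace ℂ A, (φ a ∈ C → χ (φ a) = 1) ∧ (φ a ∉ C → χ (φ a) = 0) :=
    fun φ => ⟨fun h => (hχ1 _ h).self_of_nhds,
      fun h => (hχ0 _ ⟨AlgHom.apply_mem_spectrum φ a, h⟩).self_of_nhds⟩
  obtain ⟨e, he, heφ⟩ := exists_isIdempotentElem_character_eq
    (p := (-(1 / (2 * Real.pi) : ℂ)) • ∫ z, F z) (by
      intro φ
      rw [hp]
      by_cases h : φ a ∈ C
      · simp [(hval φ).1 h]
      · simp [(hval φ).2 h])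
  exact ⟨e, he, fun φ => by rw [heφ, hp]; exact hval φ⟩

end Commutative

/-! ### Spectral parts and their Riesz idempotents. -/

/-- `C` is an open and closed subset of the spectrum of `a`. -/
def IsSpectralPart {B : Type*} [Ring B] [Algebra ℂ B] (a : B) (C : Set ℂ) : Prop :=
  C ⊆ spectrum ℂ a ∧ IsClosed C ∧ IsClosed (spectrum ℂ a \ C)

theorem IsSpectralPart.empty {B : Type*} [NormedRing B] [NormedAlgebra ℂ B] [CompleteSpace B]
    (a : B) : IsSpectralPart a ∅ :=
  ⟨Set.empty_subset _, isClosed_empty, by simp [spectrum.isClosed a]⟩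

theorem IsSpectralPart.compl {B : Type*} [Ring B] [Algebra ℂ B] {a : B} {C : Set ℂ}
    (hC : IsSpectralPart a C) : IsSpectralPart a (spectrum ℂ a \ C) :=
  ⟨Set.sdiff_subset, hC.2.2, by rw [Set.sdiff_sdiff_cancel_left hC.1]; exact hC.2.1⟩

theorem IsSpectralPart.union {B : Type*} [Ring B] [Algebra ℂ B] {a : B} {C D : Set ℂ}
    (hC : IsSpectralPart a C) (hD : IsSpectralPart a D) : IsSpectralPart a (C ∪ D) :=
  ⟨Set.union_subset hC.1 hD.1, hC.2.1.union hD.2.1, by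
    rw [← Set.sdiff_inter_sdiff]; exact hC.2.2.inter hD.2.2⟩

/-- The properties of the Riesz idempotents `e C` of the spectral parts `C` of `a`. -/
structure IsRieszFamily {B : Type*} [NormedRing B] [NormedAlgebra ℂ B] (a : B)
    (e : Set ℂ → B) : Prop where
  isIdempotentElem : ∀ {C}, IsSpectralPart a C → IsIdempotentElem (e C)
  commute : ∀ {C}, IsSpectralPart a C → Commute (e C) a
  mul_eq_zero : ∀ {C D}, IsSpectralPart a C → IsSpectralPart a D → Disjoint C D → e C * e D = 0
  union : ∀ {C D}, IsSpectralPart a C → IsSpectralPart a D → Disjoint C D →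
    e (C ∪ D) = e C + e D
  ne_zero : ∀ {C}, IsSpectralPart a C → C.Nonempty → e C ≠ 0
  spectrum_eq : e (spectrum ℂ a) = 1
  exists_inverse : ∀ {C z}, IsSpectralPart a C → z ∉ C → ∃ V, Commute V (e C) ∧
    V * (algebraMap ℂ B z - a) = e C ∧ (algebraMap ℂ B z - a) * V = e C
  exists_growth : ∀ {C D} {r : ℝ}, IsSpectralPart a C → IsSpectralPart a D → 0 < r →
    (∀ z ∈ C, ‖z‖ < r) → (∀ z ∈ D, r < ‖z‖) → ∃ α β : ℕ → B,
      Filter.Tendsto α Filter.atTop (𝓝 0) ∧ Filter.Tendsto β Filter.atTop (𝓝 0) ∧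
      ∀ k, e C * a ^ k = (r : ℂ) ^ k • α k ∧ (r : ℂ) ^ k • e D = β k * (e D * a ^ k)

section Commutative

open WeakDual

variable {A : Type*} [NormedCommRing A] [NormedAlgebra ℂ A] [CompleteSpace A]

/-- Adding 1 - f to (z - a) f gives a unit: its Gelfand transform is z - φ a over D and 1 elsewhere.
Cutting the inverse down by f gives V. -/
theorem exists_mul_algebraMap_sub_eq {a f : A} {D : Set ℂ} {z : ℂ} (hf : IsIdempotentElem f)
    (hφ : ∀ φ : characterSpace ℂ A, (φ a ∈ D → φ f = 1) ∧ (φ a ∉ D → φ f = 0)) (hz : z ∉ D) :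
    ∃ V, V * (algebraMap ℂ A z - a) = f := by
  have hu : IsUnit ((algebraMap ℂ A z - a) * f + (1 - f)) :=
    isUnit_of_character_ne_zero fun φ => by
      simp only [map_add, map_mul, map_sub, map_one, AlgHomClass.commutes, Algebra.algebraMap_self,
        RingHom.id_apply]
      by_cases h : φ a ∈ D
      · rw [(hφ φ).1 h]
        intro h0
        have : z = φ a := by linear_combination h0
        exact hz (this ▸ h)
      · simp [(hφ φ).2 h]
  obtain ⟨v, hv⟩ := hu.exists_right_inv
  refine ⟨v * f, ?_⟩
  have := hf.eq
  linear_combination f * hv + (v - (algebraMap ℂ A z - a) * v) * this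

theorem tendsto_pow_zero_of_character_lt_one [Nontrivial A] {u : A}
    (h : ∀ φ : characterSpace ℂ A, ‖φ u‖ < 1) :
    Filter.Tendsto (fun k => u ^ k) Filter.atTop (𝓝 0) := by
  obtain ⟨q, hq0, hq1, hq⟩ := exists_norm_pow_le_of_spectrum_lt u (R := 1) (by
    intro z hz
    obtain ⟨φ, rfl⟩ := CharacterSpace.mem_spectrum_iff_exists.1 hz
    exact h φ)
  exact squeeze_zero_norm' hq (tendsto_pow_atTop_nhds_zero_of_lt_one hq0 hq1)

/-- The Gelfand transform of e C is the indicator of C evaluated at φ a, so the algebraic properties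
reduce to facts about sets. -/
theorem exists_isRieszFamily_of_comm [Nontrivial A] (a : A) :
    ∃ e : Set ℂ → A, IsRieszFamily a e := by
  have hex : ∀ C, IsSpectralPart a C → ∃ e : A, IsIdempotentElem e ∧
      ∀ φ : characterSpace ℂ A, (φ a ∈ C → φ e = 1) ∧ (φ a ∉ C → φ e = 0) := fun C hC =>
    exists_riesz_idempotent a ((spectrum.isCompact a).of_isClosed_subset hC.2.1 hC.1) hC.2.2
  choose! e he hφ using hex
  have hσ : IsSpectralPart a (spectrum ℂ a) :=
    ⟨subset_rfl, spectrum.isClosed a, by simp⟩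
  refine ⟨e, fun {C} hC => he C hC, fun {C} _ => Commute.all _ _, ?_, ?_, ?_, ?_, ?_, ?_⟩
  · intro C D hC hD hCD
    refine eq_zero_of_isIdempotentElem_of_character_eq_zero ((he C hC).mul (he D hD)) fun φ => ?_
    rw [map_mul]
    by_cases h : φ a ∈ C
    · rw [(hφ D hD φ).2 (Set.disjoint_left.1 hCD h), mul_zero]
    · rw [(hφ C hC φ).2 h, zero_mul]
  · intro C D hC hD hCD
    have h0 : e C * e D = 0 :=
      eq_zero_of_isIdempotentElem_of_character_eq_zero ((he C hC).mul (he D hD)) fun φ => by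
        rw [map_mul]
        by_cases h : φ a ∈ C
        · rw [(hφ D hD φ).2 (Set.disjoint_left.1 hCD h), mul_zero]
        · rw [(hφ C hC φ).2 h, zero_mul]
    have hi : IsIdempotentElem (e C + e D) := by
      have h1 := (he C hC).eq
      have h2 := (he D hD).eq
      rw [IsIdempotentElem]
      linear_combination h1 + h2 + 2 * h0
    refine eq_of_isIdempotentElem_of_character_eq (he _ (hC.union hD)) hi fun φ => ?_
    rw [map_add]
    by_cases h : φ a ∈ C
    · rw [(hφ _ (hC.union hD) φ).1 (Or.inl h), (hφ C hC φ).1 h,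
        (hφ D hD φ).2 (Set.disjoint_left.1 hCD h), add_zero]
    · by_cases h' : φ a ∈ D
      · rw [(hφ _ (hC.union hD) φ).1 (Or.inr h'), (hφ C hC φ).2 h, (hφ D hD φ).1 h', zero_add]
      · rw [(hφ _ (hC.union hD) φ).2 (by simp [h, h']), (hφ C hC φ).2 h, (hφ D hD φ).2 h',
          add_zero]
  · rintro C hC ⟨z, hz⟩ h0
    obtain ⟨φ, rfl⟩ := CharacterSpace.mem_spectrum_iff_exists.1 (hC.1 hz)
    have := (hφ C hC φ).1 hz
    rw [h0, map_zero] at this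
    exact zero_ne_one this
  · refine eq_of_isIdempotentElem_of_character_eq (he _ hσ) IsIdempotentElem.one fun φ => ?_
    rw [(hφ _ hσ φ).1 (AlgHom.apply_mem_spectrum φ a), map_one]
  · intro C z hC hz
    obtain ⟨V, hV⟩ := exists_mul_algebraMap_sub_eq (he C hC) (hφ C hC) hz
    exact ⟨V, Commute.all _ _, hV, by rw [mul_comm, hV]⟩
  · intro C D r hC hD hr hCr hDr
    have hr0 : (r : ℂ) ≠ 0 := by exact_mod_cast hr.ne'
    have h0D : (0 : ℂ) ∉ D := fun h => (norm_zero (E := ℂ) ▸ hDr 0 h).not_ge hr.le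
    obtain ⟨V, hV⟩ := exists_mul_algebraMap_sub_eq (he D hD) (hφ D hD) h0D
    rw [map_zero, zero_sub] at hV
    -- The characters of this element are φ a / r over C and 0 elsewhere, all of modulus below 1.
    -- Next, -V inverts a on the part D, since V was chosen at the point 0, and the same argument
    -- applies.
    have h1 : Filter.Tendsto (fun k => ((r : ℂ)⁻¹ • (a * e C)) ^ k) Filter.atTop (𝓝 0) := by
      refine tendsto_pow_zero_of_character_lt_one fun φ => ?_
      by_cases h : φ a ∈ C
      · rw [map_smul, map_mul, (hφ C hC φ).1 h, mul_one, smul_eq_mul, norm_mul, norm_inv,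
          Complex.norm_real, Real.norm_of_nonneg hr.le, inv_mul_lt_iff₀ hr, mul_one]
        exact hCr _ h
      · simp [(hφ C hC φ).2 h]
    have h2 : Filter.Tendsto (fun k => ((r : ℂ) • (-V * e D)) ^ k) Filter.atTop (𝓝 0) := by
      refine tendsto_pow_zero_of_character_lt_one fun φ => ?_
      by_cases h : φ a ∈ D
      · have h3 := congrArg φ hV
        rw [map_mul, (hφ D hD φ).1 h] at h3
        have h4 : ‖φ V‖ * ‖φ a‖ = 1 := by
          rw [← norm_mul]
          rw [map_neg, mul_neg, neg_eq_iff_eq_neg] at h3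
          simp [h3]
        rw [map_smul, map_mul, (hφ D hD φ).1 h, mul_one, smul_eq_mul, norm_mul, map_neg, norm_neg,
          Complex.norm_real, Real.norm_of_nonneg hr.le, ← h4, mul_comm]
        have h5 : 0 < ‖φ V‖ := by
          refine (norm_nonneg _).lt_of_ne fun h5 => ?_
          rw [← h5, zero_mul] at h4
          exact zero_ne_one h4
        exact mul_lt_mul_of_pos_left (hDr _ h) h5
      · rw [map_smul, map_mul, (hφ D hD φ).2 h, mul_zero, smul_zero, norm_zero]
        exact one_pos
    refine ⟨fun k => e C * ((r : ℂ)⁻¹ • (a * e C)) ^ k, fun k => e D * ((r : ℂ) • (-V * e D)) ^ k,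
      by simpa using h1.const_mul (e C), by simpa using h2.const_mul (e D), fun k => ⟨?_, ?_⟩⟩
    · have h3 : e C * e C ^ k = e C := by rw [← pow_succ', (he C hC).pow_succ_eq]
      beta_reduce
      rw [smul_pow, mul_smul_comm, smul_smul, ← mul_pow, mul_inv_cancel₀ hr0, one_pow, one_smul,
        mul_pow]
      linear_combination (-a ^ k) * h3
    · have h3 : e D * e D ^ k = e D := by rw [← pow_succ', (he D hD).pow_succ_eq]
      have h4 : (-V * a) ^ k = e D ^ k := by rw [← hV, neg_mul, mul_neg]
      beta_reduce
      rw [smul_pow, mul_smul_comm, smul_mul_assoc, mul_pow]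
      congr 1
      have h5 := (he D hD).eq
      rw [mul_pow] at h4
      linear_combination (-(e D ^ k * e D * e D)) * h4 - (e D * e D ^ k + e D) * h3 - h5

end Commutative

/-! ### Passage to noncommutative algebras through the bicommutant. -/

section Bicommutant

variable {B : Type*} [NormedRing B] [NormedAlgebra ℂ B]

/-- The bicommutant of an element of a Banach algebra. -/
abbrev bicommutant (a : B) : Subalgebra ℂ B :=
  Subalgebra.centralizer ℂ (Subalgebra.centralizer ℂ {a} : Set B)

theorem mem_bicommutant_self (a : B) : a ∈ bicommutant a :=
  Set.subset_centralizer_centralizer (Set.mem_singleton a)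

noncomputable instance bicommutantNormedCommRing (a : B) : NormedCommRing (bicommutant a) :=
  { (inferInstance : NormedRing (bicommutant a)) with
    mul_comm := fun x y => Subtype.ext <| Set.centralizer_centralizer_comm_of_comm
      (by simp) _ x.2 _ y.2 }

instance bicommutant_completeSpace [CompleteSpace B] (a : B) : CompleteSpace (bicommutant a) :=
  (Set.isClosed_centralizer _).completeSpace_coe

/-- Whatever commutes with a unit commutes with its inverse, so the bicommutant is closed under
inverses and spectra do not change. -/
theorem bicommutant_isUnit_iff {a : B} {s : bicommutant a} : IsUnit s ↔ IsUnit (s : B) := by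
  refine ⟨fun h => h.map (bicommutant a).val, ?_⟩
  rintro ⟨u, hu⟩
  have hmem : (↑u⁻¹ : B) ∈ bicommutant a := by
    intro g hg
    have h : Commute g u := by rw [hu]; exact s.2 g hg
    exact h.units_inv_right
  refine IsUnit.of_mul_eq_one ⟨_, hmem⟩ (Subtype.ext ?_)
  change (s : B) * ↑u⁻¹ = 1
  rw [← hu, Units.mul_inv]

theorem spectrum_bicommutant {a : B} (s : bicommutant a) :
    spectrum ℂ s = spectrum ℂ (s : B) := by
  ext z
  rw [spectrum.mem_iff, spectrum.mem_iff, bicommutant_isUnit_iff]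
  rfl

/-- Every element of a Banach algebra has a family of Riesz idempotents. -/
theorem exists_isRieszFamily [CompleteSpace B] [Nontrivial B] (a : B) :
    ∃ e : Set ℂ → B, IsRieszFamily a e := by
  obtain ⟨e, he⟩ := exists_isRieszFamily_of_comm (⟨a, mem_bicommutant_self a⟩ : bicommutant a)
  have hσ : spectrum ℂ (⟨a, mem_bicommutant_self a⟩ : bicommutant a) = spectrum ℂ a :=
    spectrum_bicommutant _
  have hpart : ∀ {C}, IsSpectralPart a C →
      IsSpectralPart (⟨a, mem_bicommutant_self a⟩ : bicommutant a) C := by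
    intro C hC
    rwa [IsSpectralPart, hσ]
  refine ⟨fun C => (e C : B), ?_, ?_, ?_, ?_, ?_, ?_, ?_, ?_⟩
  · exact fun hC => congrArg Subtype.val (he.isIdempotentElem (hpart hC)).eq
  · exact fun hC => congrArg Subtype.val (he.commute (hpart hC)).eq
  · exact fun hC hD h => congrArg Subtype.val (he.mul_eq_zero (hpart hC) (hpart hD) h)
  · exact fun hC hD h => congrArg Subtype.val (he.union (hpart hC) (hpart hD) h)
  · exact fun hC h h0 => he.ne_zero (hpart hC) h (Subtype.ext h0)
  · have := he.spectrum_eq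
    rw [hσ] at this
    exact congrArg Subtype.val this
  · intro C z hC hz
    obtain ⟨V, h1, h2, h3⟩ := he.exists_inverse (hpart hC) hz
    exact ⟨V, congrArg Subtype.val h1.eq, congrArg Subtype.val h2, congrArg Subtype.val h3⟩
  · intro C D r hC hD hr hCr hDr
    obtain ⟨α, β, hα, hβ, h⟩ := he.exists_growth (hpart hC) (hpart hD) hr hCr hDr
    refine ⟨fun k => α k, fun k => β k, ?_, ?_, fun k => ⟨?_, ?_⟩⟩
    · exact (continuous_subtype_val.tendsto 0).comp hα
    · exact (continuous_subtype_val.tendsto 0).comp hβ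
    · exact congrArg Subtype.val (h k).1
    · exact congrArg Subtype.val (h k).2

end Bicommutant

/-! ### Stability of linear independence and a dimension count. -/

section Stability

variable {X : Type*} [NormedAddCommGroup X] [NormedSpace ℂ X]

/-- A quantitative form of the openness of linear independence. -/
theorem LinearIndependent.exists_le_norm_sum_smul {ι : Type*} [Fintype ι] {z : ι → X}
    (hz : LinearIndependent ℂ z) : ∃ δ : ℝ, 0 < δ ∧ ∀ y : ι → X, (∀ i, ‖y i - z i‖ < δ) →
      ∀ c : ι → ℂ, δ * ‖c‖ ≤ ‖∑ i, c i • y i‖ := by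
  obtain ⟨K, hK0, hK⟩ := (Fintype.linearCombination ℂ z).exists_antilipschitzWith
    (LinearMap.ker_eq_bot.2 hz.fintypeLinearCombination_injective)
  have hb : ∀ c : ι → ℂ, ‖c‖ ≤ K * ‖∑ i, c i • z i‖ := by
    intro c
    have := hK.le_mul_dist c 0
    simpa [Fintype.linearCombination_apply] using this
  have hK0' : (0 : ℝ) < K := hK0
  let m : ℝ := Fintype.card ι
  have hm : 0 ≤ m := Nat.cast_nonneg _
  refine ⟨1 / (K * (m + 1)), by positivity, fun y hy c => ?_⟩
  set δ := 1 / (K * (m + 1)) with hδ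
  have h1 : ‖∑ i, c i • z i‖ ≤ ‖∑ i, c i • y i‖ + m * (‖c‖ * δ) := by
    have h2 : ∑ i, c i • z i = ∑ i, c i • y i - ∑ i, c i • (y i - z i) := by
      simp [smul_sub]
    have h3 : ‖∑ i, c i • (y i - z i)‖ ≤ m * (‖c‖ * δ) := by
      refine (norm_sum_le _ _).trans ?_
      refine (Finset.sum_le_card_nsmul _ _ (‖c‖ * δ) fun i _ => ?_).trans (by simp [m])
      rw [norm_smul]
      exact mul_le_mul (norm_le_pi_norm c i) (hy i).le (norm_nonneg _) (norm_nonneg _)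
    rw [h2]
    exact (norm_sub_le _ _).trans (by gcongr)
  have h4 : ‖c‖ / K ≤ ‖∑ i, c i • z i‖ := by
    rw [div_le_iff₀' hK0']; exact hb c
  have h5 : ‖c‖ / K = δ * ‖c‖ + m * (‖c‖ * δ) := by
    rw [hδ]; field_simp
    ring
  linarith

theorem Submodule.finrank_add_finrank_le_of_le_of_disjoint {V : Type*} [AddCommGroup V] [Module ℂ V]
    {S₁ S₂ W : Submodule ℂ V} [FiniteDimensional ℂ W] (h₁ : S₁ ≤ W) (h₂ : S₂ ≤ W)
    (hd : Disjoint S₁ S₂) :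
    Module.finrank ℂ S₁ + Module.finrank ℂ S₂ ≤ Module.finrank ℂ W := by
  have := Submodule.finiteDimensional_of_le h₁
  have := Submodule.finiteDimensional_of_le h₂
  rw [← Submodule.finrank_sup_add_finrank_inf_eq, hd.eq_bot, finrank_bot, add_zero]
  exact Submodule.finrank_mono (sup_le h₁ h₂)

end Stability

/-! ### Orbits of subspaces and growth along two projections. -/

section Orbits

variable {X : Type*} [NormedAddCommGroup X] [NormedSpace ℂ X]

/-- The first K members of the orbit are closed subspaces, none equal to the span of x. Not lying in
any of them is therefore an open condition satisfied by x, which forces the index to be at least K.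
-/
theorem exists_large_iterate_near {n : ℕ} {T : X →L[ℂ] X} {L : Submodule ℂ X}
    (hL : IsStronglySupercyclicSubspace n T L) {x : Fin n → X} (hx : LinearIndependent ℂ x)
    (hxL : ∀ k, Submodule.span ℂ (Set.range x) ≠ L.map ((T ^ k : X →L[ℂ] X) : X →ₗ[ℂ] X))
    (K : ℕ) {ε : ℝ} (hε : 0 < ε) :
    ∃ k ≥ K, ∃ y : Fin n → X, LinearIndependent ℂ y ∧ (∀ i, ‖y i - x i‖ < ε) ∧
      Submodule.span ℂ (Set.range y) = L.map ((T ^ k : X →L[ℂ] X) : X →ₗ[ℂ] X) := by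
  obtain ⟨orbit, horb, hdense⟩ := hL
  let O : Set (IndependentTuples n X) :=
    {y | ∀ i, ‖y.1 i - x i‖ < ε} ∩ ⋂ k ∈ Set.Iio K, ⋃ i, {y | y.1 i ∉ (orbit k).1}
  have heval : ∀ i, Continuous fun y : IndependentTuples n X => y.1 i := fun i =>
    (continuous_apply i).comp continuous_subtype_val
  have hO : IsOpen O := by
    refine IsOpen.inter ?_ ((Set.finite_Iio K).isOpen_biInter fun k _ => isOpen_iUnion fun i => ?_)
    · rw [Set.ofPred_forall]
      exact isOpen_iInter_of_finite fun i =>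
        isOpen_lt ((heval i).sub continuous_const).norm continuous_const
    · have := (orbit k).2.1
      have hc : IsClosed ((orbit k).1 : Set X) := Submodule.closed_of_finiteDimensional _
      exact IsOpen.preimage (heval i) hc.isOpen_compl
  have hxO : (⟨x, hx⟩ : IndependentTuples n X) ∈ O := by
    refine ⟨fun i => by simpa using hε, ?_⟩
    simp only [Set.mem_iInter, Set.mem_iUnion]
    intro k _
    by_contra! h
    refine hxL k ?_
    rw [← horb k]
    have := (orbit k).2.1
    refine Submodule.eq_of_le_of_finrank_eq (Submodule.span_le.2 ?_) ?_
    · rintro _ ⟨i, rfl⟩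
      exact not_not.1 (h i)
    · rw [finrank_span_eq_card hx, (orbit k).2.2, Fintype.card_fin]
  obtain ⟨_, ⟨y, hyO, hy⟩, ⟨k, rfl⟩⟩ := hdense.inter_open_nonempty _
    ((isOpenQuotientMap_spanTuple n X).isOpenMap O hO) ⟨_, _, hxO, rfl⟩
  have hspan : Submodule.span ℂ (Set.range y.1) = (orbit k).1 := congrArg Subtype.val hy
  refine ⟨k, ?_, y.1, y.2, hyO.1, hspan.trans (horb k)⟩
  by_contra hk
  have h1 := hyO.2
  simp only [Set.mem_iInter, Set.mem_iUnion] at h1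
  obtain ⟨i, hi⟩ := h1 k (not_le.1 hk)
  exact hi (hspan ▸ Submodule.subset_span ⟨i, rfl⟩)

/-- A complement of L ∩ ker Q in X, intersected with L, is a complement within L by the modular law.
-/
theorem exists_inf_ker_compl (Q : X →L[ℂ] X) (L : Submodule ℂ X) :
    ∃ L₁ N : Submodule ℂ X, L₁ ≤ L ∧ N ≤ L ∧ L₁ ⊔ N = L ∧ (∀ v ∈ L₁, Q v = 0) ∧
      ∀ v ∈ N, Q v = 0 → v = 0 := by
  obtain ⟨N', hN'⟩ := Submodule.exists_isCompl (L ⊓ LinearMap.ker (Q : X →ₗ[ℂ] X))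
  refine ⟨L ⊓ LinearMap.ker (Q : X →ₗ[ℂ] X), N' ⊓ L, inf_le_left, inf_le_right, ?_,
    fun v hv => hv.2, ?_⟩
  · rw [← sup_inf_assoc_of_le N' inf_le_left, hN'.sup_eq_top, top_inf_eq]
  · rintro v ⟨hvN', hvL⟩ hv
    have h0 : v ∈ L ⊓ LinearMap.ker (Q : X →ₗ[ℂ] X) ⊓ N' := ⟨⟨hvL, hv⟩, hvN'⟩
    rwa [hN'.inf_eq_bot, Submodule.mem_bot] at h0

/-- Iterates of an `n`-dimensional subspace cannot approach the span of `x` if `T` grows slower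
along the projection `P` than along the projection `Q`, and if `P` and `Q` together have rank
greater than `n` on the span of `x`. -/
theorem not_frequently_near_of_growth {n : ℕ} {T P Q : X →L[ℂ] X} {r : ℝ} (hr : 0 < r)
    (hQT : Commute Q T) {α β : ℕ → X →L[ℂ] X}
    (hα : Filter.Tendsto α Filter.atTop (𝓝 0)) (hβ : Filter.Tendsto β Filter.atTop (𝓝 0))
    (hαβ : ∀ k, P * T ^ k = (r : ℂ) ^ k • α k ∧ (r : ℂ) ^ k • Q = β k * (Q * T ^ k))
    {x : Fin n → X} {J₁ J₂ : Finset (Fin n)} (hJ : n < J₁.card + J₂.card)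
    (hP : LinearIndependent ℂ fun i : J₁ => P (x i))
    (hQ : LinearIndependent ℂ fun i : J₂ => Q (x i))
    {L : Submodule ℂ X} [FiniteDimensional ℂ L] :
    ¬ ∀ (K : ℕ) (ε : ℝ), 0 < ε → ∃ k ≥ K, ∃ y : Fin n → X, LinearIndependent ℂ y ∧
      (∀ i, ‖y i - x i‖ < ε) ∧
      Submodule.span ℂ (Set.range y) = L.map ((T ^ k : X →L[ℂ] X) : X →ₗ[ℂ] X) := by
  intro H
  obtain ⟨δ₁, hδ₁, h₁⟩ := hP.exists_le_norm_sum_smul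
  obtain ⟨δ₂, hδ₂, h₂⟩ := hQ.exists_le_norm_sum_smul
  obtain ⟨L₁, N, hL₁L, hNL, hLN, hQL₁, hQN⟩ := exists_inf_ker_compl Q L
  have : FiniteDimensional ℂ N := Submodule.finiteDimensional_of_le hNL
  have : FiniteDimensional ℂ L₁ := Submodule.finiteDimensional_of_le hL₁L
  have hker : LinearMap.ker ((Q : X →ₗ[ℂ] X) ∘ₗ N.subtype) = ⊥ := by
    rw [LinearMap.ker_eq_bot']
    exact fun v hv => Subtype.ext (hQN v v.2 hv)
  obtain ⟨c, hc0, hc⟩ := LinearMap.exists_antilipschitzWith _ hker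
  have hcN : ∀ v ∈ N, ‖v‖ ≤ c * ‖Q v‖ := by
    intro v hv
    have := hc.le_mul_dist ⟨v, hv⟩ 0
    simpa using this
  let M : ℝ := ∑ i, (‖x i‖ + 1)
  have hM : 0 ≤ M := Finset.sum_nonneg fun i _ => by positivity
  -- This is the factor that appears in `e5`; once it is below δ₁, the coefficients d there must
  -- vanish.
  have hlim : Filter.Tendsto (fun k => c * (‖α k‖ * ‖β k‖) * (‖Q‖ * M)) Filter.atTop (𝓝 0) := by
    have h := ((hα.norm.mul hβ.norm).const_mul (c : ℝ)).mul_const (‖Q‖ * M)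
    simpa using h
  obtain ⟨K, hK⟩ := Filter.eventually_atTop.1 (hlim.eventually_lt_const hδ₁)
  obtain ⟨k, hk, y, hy, hyx, hspan⟩ := H K (min 1 (min (δ₁ / (‖P‖ + 1)) (δ₂ / (‖Q‖ + 1))))
    (by positivity)
  have hy1 : ∀ i, ‖y i‖ ≤ ‖x i‖ + 1 := by
    intro i
    have h1 := (hyx i).le.trans (min_le_left _ _)
    have h2 := norm_add_le (x i) (y i - x i)
    rw [add_sub_cancel] at h2
    linarith
  have hclose : ∀ (R : X →L[ℂ] X) {δ : ℝ} {v : X}, ‖v‖ < δ / (‖R‖ + 1) → ‖R v‖ < δ := by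
    intro R δ v hv
    rw [lt_div_iff₀ (by positivity)] at hv
    have := R.le_opNorm v
    nlinarith [norm_nonneg v]
  have hyP : ∀ i : J₁, ‖P (y i) - P (x i)‖ < δ₁ := fun i => by
    rw [← map_sub]
    exact hclose P ((hyx i).trans_le ((min_le_right _ _).trans (min_le_left _ _)))
  have hyQ : ∀ i : J₂, ‖Q (y i) - Q (x i)‖ < δ₂ := fun i => by
    rw [← map_sub]
    exact hclose Q ((hyx i).trans_le ((min_le_right _ _).trans (min_le_right _ _)))
  let S : X →ₗ[ℂ] X := ((T ^ k : X →L[ℂ] X) : X →ₗ[ℂ] X)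
  have hfin : FiniteDimensional ℂ (L.map S) := inferInstance
  have hW : Module.finrank ℂ (L.map S) = n := by
    rw [← hspan, finrank_span_eq_card hy, Fintype.card_fin]
  have hsub : ∀ J : Finset (Fin n), Submodule.span ℂ (Set.range fun i : J => y i) ≤ L.map S ∧
      Module.finrank ℂ (Submodule.span ℂ (Set.range fun i : J => y i)) = J.card := by
    intro J
    constructor
    · rw [← hspan]
      refine Submodule.span_mono ?_
      rintro _ ⟨i, rfl⟩
      exact ⟨i, rfl⟩
    · have := finrank_span_eq_card (hy.comp ((↑) : J → Fin n) Subtype.val_injective)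
      rwa [Fintype.card_coe] at this
  -- Q kills T^k L₁ because it commutes with T, but it is bounded below on combinations of the y i
  -- with i in J₂.
  have hd₂ : Disjoint (Submodule.span ℂ (Set.range fun i : J₂ => y i)) (L₁.map S) := by
    rw [Submodule.disjoint_def]
    rintro _ hw ⟨v, hv, rfl⟩
    obtain ⟨d, hd⟩ := (Submodule.mem_span_range_iff_exists_fun ℂ).1 hw
    have hQv : Q v = 0 := hQL₁ v hv
    have hQ0 : Q (S v) = 0 := by
      have h3 := DFunLike.congr_fun (hQT.pow_right k).eq v
      simp only [mul_apply_eq_comp] at h3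
      exact h3.trans (by rw [hQv, map_zero])
    have h3 := h₂ (fun i => Q (y i)) hyQ d
    have h4 : ∑ i, d i • Q (y i) = Q (S v) := by rw [← hd, map_sum]; simp
    rw [h4, hQ0, norm_zero] at h3
    have h5 : ‖d‖ = 0 := by nlinarith [norm_nonneg d]
    rw [norm_eq_zero] at h5
    rw [← hd, h5]; simp
  -- For v in N the norm of v is controlled by Q v, so P T^k v is small relative to T^k v, while P
  -- is bounded below on combinations of the y i with i in J₁.
  have hd₁ : Disjoint (Submodule.span ℂ (Set.range fun i : J₁ => y i)) (N.map S) := by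
    rw [Submodule.disjoint_def]
    rintro _ hw ⟨v, hv, rfl⟩
    obtain ⟨d, hd⟩ := (Submodule.mem_span_range_iff_exists_fun ℂ).1 hw
    have hrk : 0 < r ^ k := pow_pos hr k
    have hnr : ‖(r : ℂ) ^ k‖ = r ^ k := by
      rw [norm_pow, Complex.norm_real, Real.norm_of_nonneg hr.le]
    have e1 : ‖P (S v)‖ ≤ r ^ k * (‖α k‖ * ‖v‖) := by
      have h3 : P (S v) = (r : ℂ) ^ k • α k v := DFunLike.congr_fun (hαβ k).1 v
      rw [h3, norm_smul, hnr]
      gcongr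
      exact (α k).le_opNorm v
    have e2 : r ^ k * ‖Q v‖ ≤ ‖β k‖ * (‖Q‖ * ‖S v‖) := by
      have h3 : (r : ℂ) ^ k • Q v = β k (Q (S v)) := DFunLike.congr_fun (hαβ k).2 v
      rw [← hnr, ← norm_smul, h3]
      refine ((β k).le_opNorm _).trans ?_
      gcongr
      exact Q.le_opNorm _
    have e3 : ‖S v‖ ≤ ‖d‖ * M := by
      rw [← hd]
      refine (norm_sum_le _ _).trans ?_
      calc ∑ i : J₁, ‖d i • y i‖ ≤ ∑ i : J₁, ‖d‖ * (‖x i‖ + 1) := by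
            refine Finset.sum_le_sum fun i _ => ?_
            rw [norm_smul]
            exact mul_le_mul (norm_le_pi_norm d i) (hy1 i) (norm_nonneg _) (norm_nonneg _)
        _ = ‖d‖ * ∑ i ∈ J₁, (‖x i‖ + 1) := by
            rw [← Finset.mul_sum, Finset.sum_coe_sort J₁ fun i => ‖x i‖ + 1]
        _ ≤ ‖d‖ * M := by
            gcongr
            exact Finset.sum_le_sum_of_subset_of_nonneg (Finset.subset_univ _)
              fun i _ _ => by positivity
    have e4 : δ₁ * ‖d‖ ≤ ‖P (S v)‖ := by
      have h3 := h₁ (fun i => P (y i)) hyP d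
      have h4 : ∑ i, d i • P (y i) = P (S v) := by rw [← hd, map_sum]; simp
      rwa [h4] at h3
    have e5 : ‖P (S v)‖ ≤ c * (‖α k‖ * ‖β k‖) * (‖Q‖ * M) * ‖d‖ :=
      calc ‖P (S v)‖ ≤ r ^ k * (‖α k‖ * (c * ‖Q v‖)) :=
            e1.trans (by gcongr; exact hcN v hv)
        _ = c * ‖α k‖ * (r ^ k * ‖Q v‖) := by ring
        _ ≤ c * ‖α k‖ * (‖β k‖ * (‖Q‖ * (‖d‖ * M))) := by
            refine mul_le_mul_of_nonneg_left (e2.trans ?_) (by positivity)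
            gcongr
        _ = _ := by ring
    have h5 : ‖d‖ = 0 := by
      have := hK k hk
      by_contra h0
      have hpos : 0 < ‖d‖ := (norm_nonneg d).lt_of_ne' h0
      nlinarith
    rw [norm_eq_zero] at h5
    rw [← hd, h5]; simp
  -- The disjointness bounds give |J₁| + |J₂| + dim T^k L₁ + dim T^k N ≤ 2n, and the last two
  -- dimensions add up to at least n.
  have hsum : L₁.map S ⊔ N.map S = L.map S := by rw [← Submodule.map_sup, hLN]
  have hle : ∀ {U : Submodule ℂ X}, U ≤ L → U.map S ≤ L.map S := fun h => Submodule.map_mono h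
  have f1 := Submodule.finrank_add_finrank_le_of_le_of_disjoint (hsub J₁).1
    (hle hNL) hd₁
  have f2 := Submodule.finrank_add_finrank_le_of_le_of_disjoint (hsub J₂).1
    (hle hL₁L) hd₂
  have f3 := Submodule.finrank_add_le_finrank_add_finrank (L₁.map S) (N.map S)
  rw [hsum] at f3
  rw [(hsub J₁).2] at f1
  rw [(hsub J₂).2] at f2
  omega

end Orbits

/-! ### The rank bound for separated projections. -/

section Rank

variable {X : Type*} [NormedAddCommGroup X] [NormedSpace ℂ X]

theorem eq_zero_of_sum_smul_map_eq_zero {n : ℕ} {P : X →L[ℂ] X} {x : Fin n → X}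
    {J : Finset (Fin n)} (hP : LinearIndependent ℂ fun i : J => P (x i))
    (hP0 : ∀ i ∉ J, P (x i) = 0) {d : Fin n → ℂ} (h : ∑ i, d i • P (x i) = 0) :
    ∀ i ∈ J, d i = 0 := by
  have h1 : ∑ i : J, d i • P (x i) = 0 := by
    rw [Finset.sum_coe_sort J fun i => d i • P (x i), ← h]
    exact Finset.sum_subset (Finset.subset_univ _) fun i _ hi => by rw [hP0 i hi, smul_zero]
  exact fun i hi => Fintype.linearIndependent_iff.1 hP (fun i => d i) h1 ⟨i, hi⟩

theorem linearIndependent_of_map {n : ℕ} {P Q : X →L[ℂ] X} {x : Fin n → X}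
    {J₁ J₂ : Finset (Fin n)} (hP : LinearIndependent ℂ fun i : J₁ => P (x i))
    (hQ : LinearIndependent ℂ fun i : J₂ => Q (x i)) (hP0 : ∀ i ∉ J₁, P (x i) = 0)
    (hQ0 : ∀ i ∉ J₂, Q (x i) = 0) (hJ : ∀ i, i ∈ J₁ ∨ i ∈ J₂) : LinearIndependent ℂ x := by
  rw [Fintype.linearIndependent_iff]
  intro d hd i
  have h1 := congrArg P hd
  have h2 := congrArg Q hd
  simp only [map_sum, map_smul, map_zero] at h1 h2
  rcases hJ i with hi | hi
  · exact eq_zero_of_sum_smul_map_eq_zero hP hP0 h1 i hi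
  · exact eq_zero_of_sum_smul_map_eq_zero hQ hQ0 h2 i hi

/-- If Q (x j) were a combination of the x i, applying P would make its j-th coefficient 0 and
applying Q would make it 1. -/
theorem map_notMem_span {n : ℕ} {P Q : X →L[ℂ] X} (hPQ : P * Q = 0) (hQQ : IsIdempotentElem Q)
    {x : Fin n → X} {J₁ J₂ : Finset (Fin n)} (hP : LinearIndependent ℂ fun i : J₁ => P (x i))
    (hQ : LinearIndependent ℂ fun i : J₂ => Q (x i)) (hP0 : ∀ i ∉ J₁, P (x i) = 0)
    (hQ0 : ∀ i ∉ J₂, Q (x i) = 0) {j : Fin n} (h₁ : j ∈ J₁) (h₂ : j ∈ J₂) :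
    Q (x j) ∉ Submodule.span ℂ (Set.range x) := by
  intro hmem
  obtain ⟨d, hd⟩ := (Submodule.mem_span_range_iff_exists_fun ℂ).1 hmem
  have hPQ' : P (Q (x j)) = 0 := DFunLike.congr_fun hPQ (x j)
  have hQQ' : Q (Q (x j)) = Q (x j) := DFunLike.congr_fun hQQ.eq (x j)
  have h1 := congrArg P hd
  have h2 := congrArg Q hd
  simp only [map_sum, map_smul, hPQ', hQQ'] at h1 h2
  have h3 : ∑ i, (d i - if i = j then 1 else 0) • Q (x i) = 0 := by
    simp [sub_smul, h2]
  have h4 := eq_zero_of_sum_smul_map_eq_zero hP hP0 h1 j h₁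
  have h5 := eq_zero_of_sum_smul_map_eq_zero hQ hQ0 h3 j h₂
  simp [h4] at h5

/-- The shared index j pushes the total rank above n. It also allows moving x j along Q (x j), which
yields uncountably many spans, more than the orbit can contain. -/
theorem not_isStronglySupercyclic_of_growth {n : ℕ} {T P Q : X →L[ℂ] X} (hPQ : P * Q = 0)
    (hQQ : IsIdempotentElem Q) {r : ℝ} (hr : 0 < r)
    (hQT : Commute Q T) {α β : ℕ → X →L[ℂ] X}
    (hα : Filter.Tendsto α Filter.atTop (𝓝 0)) (hβ : Filter.Tendsto β Filter.atTop (𝓝 0))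
    (hαβ : ∀ k, P * T ^ k = (r : ℂ) ^ k • α k ∧ (r : ℂ) ^ k • Q = β k * (Q * T ^ k))
    {x : Fin n → X} {J₁ J₂ : Finset (Fin n)}
    (hP : LinearIndependent ℂ fun i : J₁ => P (x i))
    (hQ : LinearIndependent ℂ fun i : J₂ => Q (x i)) (hP0 : ∀ i ∉ J₁, P (x i) = 0)
    (hQ0 : ∀ i ∉ J₂, Q (x i) = 0) (hJ : ∀ i, i ∈ J₁ ∨ i ∈ J₂) {j : Fin n} (h₁ : j ∈ J₁)
    (h₂ : j ∈ J₂) : ¬ IsStronglySupercyclic n T := by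
  rintro ⟨L, hL⟩
  have hcard : n < J₁.card + J₂.card := by
    have hu : J₁ ∪ J₂ = Finset.univ := by
      ext i; simpa using hJ i
    have hi : 0 < (J₁ ∩ J₂).card := Finset.card_pos.2 ⟨j, Finset.mem_inter.2 ⟨h₁, h₂⟩⟩
    have := Finset.card_union_add_card_inter J₁ J₂
    rw [hu, Finset.card_univ, Fintype.card_fin] at this
    omega
  have hLfin : FiniteDimensional ℂ L := by
    obtain ⟨orbit, horb, -⟩ := hL
    have h0 : (orbit 0).1 = L := by
      rw [horb 0, pow_zero]; exact Submodule.map_id L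
    exact h0 ▸ (orbit 0).2.1
  -- perturb `x` so that its span avoids the countable orbit of `L`
  let z : ℂ → Fin n → X := fun t i => x i + if i = j then t • Q (x j) else 0
  have hPQ' : ∀ v, P (Q v) = 0 := DFunLike.congr_fun hPQ
  have hQQ' : ∀ v, Q (Q v) = Q v := DFunLike.congr_fun hQQ.eq
  have hPz : ∀ t i, P (z t i) = P (x i) := by
    intro t i
    simp only [z]
    split_ifs <;> simp [hPQ']
  have hQz : ∀ t i, Q (z t i) = (if i = j then 1 + t else 1) • Q (x i) := by
    intro t i
    simp only [z]
    split_ifs with h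
    · subst h; simp [hQQ', add_smul]
    · simp
  have hzP : ∀ t, LinearIndependent ℂ fun i : J₁ => P (z t i) := by
    intro t; simpa only [hPz] using hP
  -- The value t = -1 would erase the Q-component of x j.
  have hzQ : ∀ t, t ≠ -1 → LinearIndependent ℂ fun i : J₂ => Q (z t i) := by
    intro t ht
    have ht' : 1 + t ≠ 0 := fun h => ht (by linear_combination h)
    have := hQ.units_smul fun i => if i.1 = j then Units.mk0 (1 + t) ht' else 1
    convert this using 2 with i
    rw [hQz, Pi.smul_apply']
    split_ifs <;> simp [Units.smul_def]
  have hzP0 : ∀ t, ∀ i ∉ J₁, P (z t i) = 0 := fun t i hi => by rw [hPz, hP0 i hi]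
  have hzQ0 : ∀ t, ∀ i ∉ J₂, Q (z t i) = 0 := fun t i hi => by rw [hQz, hQ0 i hi, smul_zero]
  have hinj : ∀ s t, t ≠ -1 →
      Submodule.span ℂ (Set.range (z s)) = Submodule.span ℂ (Set.range (z t)) → s = t := by
    intro s t ht hst
    by_contra hne
    have hs : z s j ∈ Submodule.span ℂ (Set.range (z t)) :=
      hst ▸ Submodule.subset_span ⟨j, rfl⟩
    have h3 : z s j - z t j ∈ Submodule.span ℂ (Set.range (z t)) :=
      Submodule.sub_mem _ hs (Submodule.subset_span ⟨j, rfl⟩)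
    have h4 : z s j - z t j = (s - t) • Q (x j) := by simp [z, sub_smul]
    rw [h4, Submodule.smul_mem_iff _ (sub_ne_zero.2 hne)] at h3
    refine map_notMem_span hPQ hQQ (hzP t) (hzQ t ht) (hzP0 t) (hzQ0 t) h₁ h₂ ?_
    rw [hQz]
    exact Submodule.smul_mem _ _ h3
  obtain ⟨t, ht, htL⟩ : ∃ t : ℂ, t ≠ -1 ∧ ∀ k, Submodule.span ℂ (Set.range (z t)) ≠
      L.map ((T ^ k : X →L[ℂ] X) : X →ₗ[ℂ] X) := by
    by_contra! H
    choose κ hκ using H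
    have hinj' : Function.Injective fun t : {t : ℂ // t ≠ -1} => κ t.1 t.2 := by
      rintro ⟨s, hs⟩ ⟨t, ht⟩ hst
      refine Subtype.ext (hinj s t ht ?_)
      simp only at hst
      rw [hκ s hs, hκ t ht, hst]
    have hc : Set.Countable {t : ℂ | t ≠ -1} := Set.countable_coe_iff.1 hinj'.countable
    refine not_countable_complex ((hc.union (Set.countable_singleton (-1))).mono ?_)
    intro t _
    by_cases h : t = -1
    · exact Or.inr h
    · exact Or.inl h
  exact not_frequently_near_of_growth hr hQT hα hβ hαβ hcard (hzP t) (hzQ t ht) fun K ε hε =>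
    exists_large_iterate_near hL
      (linearIndependent_of_map (hzP t) (hzQ t ht) (hzP0 t) (hzQ0 t) hJ) htL K hε

/-- The a + 1 vectors v and the b + 1 vectors w are packed into a + b + 1 places, with the sum of
the last v and the first w at index a. -/
theorem not_isStronglySupercyclic_of_linearIndependent {a b : ℕ} {T P Q : X →L[ℂ] X}
    (hPP : IsIdempotentElem P) (hQQ : IsIdempotentElem Q) (hPQ : P * Q = 0) (hQP : Q * P = 0)
    {r : ℝ} (hr : 0 < r) (hQT : Commute Q T) {α β : ℕ → X →L[ℂ] X}
    (hα : Filter.Tendsto α Filter.atTop (𝓝 0)) (hβ : Filter.Tendsto β Filter.atTop (𝓝 0))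
    (hαβ : ∀ k, P * T ^ k = (r : ℂ) ^ k • α k ∧ (r : ℂ) ^ k • Q = β k * (Q * T ^ k))
    {v : Fin (a + 1) → LinearMap.range (P : X →ₗ[ℂ] X)} (hv : LinearIndependent ℂ v)
    {w : Fin (b + 1) → LinearMap.range (Q : X →ₗ[ℂ] X)} (hw : LinearIndependent ℂ w) :
    ¬ IsStronglySupercyclic (a + b + 1) T := by
  have hv' : LinearIndependent ℂ fun i => (v i : X) :=
    hv.map' (Submodule.subtype _) (Submodule.ker_subtype _)
  have hw' : LinearIndependent ℂ fun i => (w i : X) :=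
    hw.map' (Submodule.subtype _) (Submodule.ker_subtype _)
  have hPv : ∀ i, P (v i) = v i := fun i => by
    obtain ⟨y, hy⟩ := (v i).2
    rw [← hy]; exact DFunLike.congr_fun hPP.eq y
  have hQv : ∀ i, Q (v i) = 0 := fun i => by
    obtain ⟨y, hy⟩ := (v i).2
    rw [← hy]; exact DFunLike.congr_fun hQP y
  have hQw : ∀ i, Q (w i) = w i := fun i => by
    obtain ⟨y, hy⟩ := (w i).2
    rw [← hy]; exact DFunLike.congr_fun hQQ.eq y
  have hPw : ∀ i, P (w i) = 0 := fun i => by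
    obtain ⟨y, hy⟩ := (w i).2
    rw [← hy]; exact DFunLike.congr_fun hPQ y
  let x : Fin (a + b + 1) → X := fun i =>
    (if h : i.1 ≤ a then (v ⟨i, by omega⟩ : X) else 0) +
      (if h : a ≤ i.1 then (w ⟨i - a, by omega⟩ : X) else 0)
  have hPx : ∀ i, P (x i) = if h : i.1 ≤ a then (v ⟨i, by omega⟩ : X) else 0 := by
    intro i
    simp only [x, map_add]
    split_ifs <;> simp [hPv, hPw]
  have hQx : ∀ i, Q (x i) = if h : a ≤ i.1 then (w ⟨i - a, by omega⟩ : X) else 0 := by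
    intro i
    simp only [x, map_add]
    split_ifs <;> simp [hQv, hQw]
  refine not_isStronglySupercyclic_of_growth hPQ hQQ hr hQT hα hβ hαβ (x := x)
    (J₁ := Finset.univ.filter fun i => i.1 ≤ a) (J₂ := Finset.univ.filter fun i => a ≤ i.1)
    ?_ ?_ ?_ ?_ ?_ (j := ⟨a, by omega⟩) (by simp) (by simp)
  · have hmem : ∀ i : (Finset.univ.filter fun i : Fin (a + b + 1) => i.1 ≤ a), i.1.1 ≤ a :=
      fun i => (Finset.mem_filter.1 i.2).2
    have := hv'.comp (fun i : (Finset.univ.filter fun i : Fin (a + b + 1) => i.1 ≤ a) =>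
      (⟨i.1.1, Nat.lt_succ_of_le (hmem i)⟩ : Fin (a + 1))) (by
        intro i k hik
        simp only [Fin.mk.injEq] at hik
        exact Subtype.ext (Fin.ext hik))
    rw [show (fun i : (Finset.univ.filter fun i : Fin (a + b + 1) => i.1 ≤ a) => P (x i)) = _ from
      funext fun i => (hPx i).trans (dif_pos (hmem i))]
    exact this
  · have hmem : ∀ i : (Finset.univ.filter fun i : Fin (a + b + 1) => a ≤ i.1), a ≤ i.1.1 :=
      fun i => (Finset.mem_filter.1 i.2).2
    have := hw'.comp (fun i : (Finset.univ.filter fun i : Fin (a + b + 1) => a ≤ i.1) =>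
      (⟨i.1.1 - a, by omega⟩ : Fin (b + 1))) (by
        intro i k hik
        simp only [Fin.mk.injEq] at hik
        have h1 := hmem i
        have h2 := hmem k
        exact Subtype.ext (Fin.ext (by omega)))
    rw [show (fun i : (Finset.univ.filter fun i : Fin (a + b + 1) => a ≤ i.1) => Q (x i)) = _ from
      funext fun i => (hQx i).trans (dif_pos (hmem i))]
    exact this
  · intro i hi
    rw [hPx, dif_neg (by simpa using hi)]
  · intro i hi
    rw [hQx, dif_neg (by simpa using hi)]
  · intro i
    simpa using le_total i.1 a

/-- For a strongly `n`-supercyclic operator, the ranges of two projections that separate the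
growth of the iterates have total dimension at most `n`. -/
theorem IsStronglySupercyclic.finrank_range_add_le {n : ℕ} (hn : 1 ≤ n) {T P Q : X →L[ℂ] X}
    (hT : IsStronglySupercyclic n T) (hP0 : P ≠ 0) (hQ0 : Q ≠ 0)
    (hPP : IsIdempotentElem P) (hQQ : IsIdempotentElem Q) (hPQ : P * Q = 0) (hQP : Q * P = 0)
    {r : ℝ} (hr : 0 < r) (hQT : Commute Q T) {α β : ℕ → X →L[ℂ] X}
    (hα : Filter.Tendsto α Filter.atTop (𝓝 0)) (hβ : Filter.Tendsto β Filter.atTop (𝓝 0))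
    (hαβ : ∀ k, P * T ^ k = (r : ℂ) ^ k • α k ∧ (r : ℂ) ^ k • Q = β k * (Q * T ^ k)) :
    FiniteDimensional ℂ (LinearMap.range (P : X →ₗ[ℂ] X)) ∧
    FiniteDimensional ℂ (LinearMap.range (Q : X →ₗ[ℂ] X)) ∧
    Module.finrank ℂ (LinearMap.range (P : X →ₗ[ℂ] X)) +
      Module.finrank ℂ (LinearMap.range (Q : X →ₗ[ℂ] X)) ≤ n := by
  have key : ∀ a b : ℕ, a + b + 1 = n →
      ((a + 1 : ℕ) : Cardinal) ≤ Module.rank ℂ (LinearMap.range (P : X →ₗ[ℂ] X)) →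
      ((b + 1 : ℕ) : Cardinal) ≤ Module.rank ℂ (LinearMap.range (Q : X →ₗ[ℂ] X)) → False := by
    rintro a b rfl ha hb
    obtain ⟨v, hv⟩ := exists_linearIndependent_of_le_rank ha
    obtain ⟨w, hw⟩ := exists_linearIndependent_of_le_rank hb
    exact not_isStronglySupercyclic_of_linearIndependent hPP hQQ hPQ hQP hr hQT hα hβ hαβ hv hw hT
  have hone : ∀ R : X →L[ℂ] X, R ≠ 0 →
      ((0 + 1 : ℕ) : Cardinal) ≤ Module.rank ℂ (LinearMap.range (R : X →ₗ[ℂ] X)) := by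
    intro R hR
    rw [zero_add, Nat.cast_one, Cardinal.one_le_iff_ne_zero, Ne, rank_zero_iff]
    intro h
    refine hR (ContinuousLinearMap.ext fun v => ?_)
    exact congrArg Subtype.val
      (Subsingleton.elim (⟨R v, v, rfl⟩ : LinearMap.range (R : X →ₗ[ℂ] X)) 0)
  have hfin : ∀ R : X →L[ℂ] X,
      ¬ ((n : ℕ) : Cardinal) ≤ Module.rank ℂ (LinearMap.range (R : X →ₗ[ℂ] X)) →
      FiniteDimensional ℂ (LinearMap.range (R : X →ₗ[ℂ] X)) := fun R hR =>
    Module.rank_lt_aleph0_iff.1 ((not_le.1 hR).trans (Cardinal.natCast_lt_aleph0))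
  have hn' : n - 1 + 1 = n := by omega
  -- A nonzero projection has rank at least 1, so the other one cannot have rank n or more.
  have hPfin := hfin P fun h => key (n - 1) 0 (by omega) (by rwa [hn']) (hone Q hQ0)
  have hQfin := hfin Q fun h => key 0 (n - 1) (by omega) (hone P hP0) (by rwa [hn'])
  refine ⟨hPfin, hQfin, ?_⟩
  have hP1 := hone P hP0
  have hQ1 := hone Q hQ0
  rw [← Module.finrank_eq_rank, Nat.cast_le] at hP1 hQ1
  rw [← Module.finrank_eq_rank, ← Module.finrank_eq_rank] at key
  simp only [Nat.cast_le] at key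
  by_contra! hlt
  set p := Module.finrank ℂ (LinearMap.range (P : X →ₗ[ℂ] X))
  set q := Module.finrank ℂ (LinearMap.range (Q : X →ₗ[ℂ] X))
  by_cases hpn : p ≤ n
  · exact key (p - 1) (n - p) (by omega) (by omega) (by omega)
  · exact key (n - 1) 0 (by omega) (by omega) (by omega)

end Rank

/-! ### Components of compact sets and circles. -/

section Components

/-- In a compact Hausdorff space a component is the intersection of the clopen sets around it; these
form a directed family, so by compactness one of them already lies in U. -/
theorem exists_isClosed_subset_of_connectedComponentIn_subset {K U : Set ℂ} (hK : IsCompact K)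
    (hU : IsOpen U) {z : ℂ} (hz : z ∈ K) (h : connectedComponentIn K z ⊆ U) :
    ∃ C ⊆ K, z ∈ C ∧ C ⊆ U ∧ IsClosed C ∧ IsClosed (K \ C) := by
  have : CompactSpace K := isCompact_iff_compactSpace.1 hK
  let V : {s : Set K // IsClopen s ∧ (⟨z, hz⟩ : K) ∈ s} → Set K := fun s => s.1
  have hne : Nonempty {s : Set K // IsClopen s ∧ (⟨z, hz⟩ : K) ∈ s} :=
    ⟨⟨Set.univ, isClopen_univ, Set.mem_univ _⟩⟩
  have hV : Directed (· ⊇ ·) V := fun s t =>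
    ⟨⟨s.1 ∩ t.1, s.2.1.inter t.2.1, s.2.2, t.2.2⟩, Set.inter_subset_left, Set.inter_subset_right⟩
  obtain ⟨s, hs⟩ := exists_subset_nhds_of_compactSpace hV (fun s => s.2.1.isClosed)
    (U := ((↑) : K → ℂ) ⁻¹' U) (by
      intro x hx
      refine (hU.preimage continuous_subtype_val).mem_nhds (h ?_)
      rw [connectedComponentIn_eq_image hz, connectedComponent_eq_iInter_isClopen]
      exact ⟨x, hx, rfl⟩)
  have hemb := hK.isClosed.isClosedEmbedding_subtypeVal
  refine ⟨(↑) '' s.1, ?_, ⟨_, s.2.2, rfl⟩, ?_, hemb.isClosedMap _ s.2.1.isClosed, ?_⟩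
  · rintro _ ⟨x, -, rfl⟩
    exact x.2
  · rintro _ ⟨x, hx, rfl⟩
    exact hs hx
  · have : K \ ((↑) '' s.1) = ((↑) : K → ℂ) '' s.1ᶜ := by
      rw [Set.image_compl_eq_range_sdiff_image Subtype.val_injective, Subtype.range_coe]
    rw [this]
    exact hemb.isClosedMap _ s.2.1.compl.isClosed

/-- A component of a compact set that misses a circle lies in an open and closed subset on one side
of the circle. -/
theorem exists_isClosed_subset_of_sphere_inter_eq_empty {K : Set ℂ} (hK : IsCompact K) {R : ℝ}
    {z : ℂ} (hz : z ∈ K)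
    (h : ¬ (Metric.sphere (0 : ℂ) R ∩ connectedComponentIn K z).Nonempty) :
    ∃ C ⊆ K, z ∈ C ∧ IsClosed C ∧ IsClosed (K \ C) ∧
      ((∀ w ∈ C, ‖w‖ < R) ∨ ∀ w ∈ C, R < ‖w‖) := by
  have h1 : IsOpen {w : ℂ | ‖w‖ < R} := isOpen_lt continuous_norm continuous_const
  have h2 : IsOpen {w : ℂ | R < ‖w‖} := isOpen_lt continuous_const continuous_norm
  have hsub : connectedComponentIn K z ⊆ {w : ℂ | ‖w‖ < R} ∨
      connectedComponentIn K z ⊆ {w : ℂ | R < ‖w‖} := by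
    refine isPreconnected_connectedComponentIn.subset_or_subset h1 h2 ?_ ?_
    · exact Set.disjoint_left.2 fun w (hw : ‖w‖ < R) (hw' : R < ‖w‖) => hw.not_gt hw'
    · intro w hw
      rcases lt_trichotomy ‖w‖ R with h3 | h3 | h3
      · exact Or.inl h3
      · exact absurd ⟨w, by simpa using h3, hw⟩ h
      · exact Or.inr h3
  rcases hsub with hs | hs
  · obtain ⟨C, hCK, hzC, hCU, hC, hC'⟩ :=
      exists_isClosed_subset_of_connectedComponentIn_subset hK h1 hz hs
    exact ⟨C, hCK, hzC, hC, hC', Or.inl hCU⟩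
  · obtain ⟨C, hCK, hzC, hCU, hC, hC'⟩ :=
      exists_isClosed_subset_of_connectedComponentIn_subset hK h2 hz hs
    exact ⟨C, hCK, hzC, hC, hC', Or.inr hCU⟩

end Components

/-! ### Riesz decompositions of an operator and the choice of the circle. -/

section Riesz

variable {X : Type*} [NormedAddCommGroup X] [NormedSpace ℂ X] {T : X →L[ℂ] X}
  {e : Set ℂ → X →L[ℂ] X}

theorem IsRieszFamily.empty_eq_zero [CompleteSpace X] (he : IsRieszFamily T e) : e ∅ = 0 := by
  have h := he.mul_eq_zero (.empty T) (.empty T) (Set.disjoint_empty ∅)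
  rwa [(he.isIdempotentElem (.empty T)).eq] at h

theorem IsRieszFamily.compl (he : IsRieszFamily T e) {C : Set ℂ} (hC : IsSpectralPart T C) :
    e (spectrum ℂ T \ C) = 1 - e C := by
  have h := he.union hC hC.compl Set.disjoint_sdiff_right
  rw [Set.union_sdiff_cancel hC.1, he.spectrum_eq] at h
  rw [h]; abel

theorem IsRieszFamily.map_mem_range (he : IsRieszFamily T e) {C : Set ℂ}
    (hC : IsSpectralPart T C) : ∀ x ∈ LinearMap.range (e C : X →ₗ[ℂ] X),
      T x ∈ LinearMap.range (e C : X →ₗ[ℂ] X) := by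
  rintro _ ⟨x, rfl⟩
  exact ⟨T x, DFunLike.congr_fun (he.commute hC).eq x⟩

theorem IsRieszFamily.map_mem_ker (he : IsRieszFamily T e) {C : Set ℂ}
    (hC : IsSpectralPart T C) : ∀ x ∈ LinearMap.ker (e C : X →ₗ[ℂ] X),
      T x ∈ LinearMap.ker (e C : X →ₗ[ℂ] X) := by
  intro x hx
  have h : e C (T x) = T (e C x) := DFunLike.congr_fun (he.commute hC).eq x
  have hx' : e C x = 0 := hx
  change e C (T x) = 0
  rw [h, hx', map_zero]

/-- The spectrum of the restriction of `T` to the kernel of a Riesz idempotent. -/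
theorem IsRieszFamily.spectrum_restrict_ker [CompleteSpace X] (he : IsRieszFamily T e) {C : Set ℂ}
    (hC : IsSpectralPart T C)
    (hX : ∀ x ∈ LinearMap.ker (e C : X →ₗ[ℂ] X), T x ∈ LinearMap.ker (e C : X →ₗ[ℂ] X)) :
    spectrum ℂ (T.restrict hX : LinearMap.ker (e C : X →ₗ[ℂ] X) →L[ℂ]
      LinearMap.ker (e C : X →ₗ[ℂ] X)) = spectrum ℂ T \ C := by
  have hcl : IsClosed (LinearMap.ker (e C : X →ₗ[ℂ] X) : Set X) :=
    isClosed_singleton.preimage (e C).continuous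
  have : CompleteSpace (LinearMap.ker (e C : X →ₗ[ℂ] X)) := hcl.completeSpace_coe
  have hval : ∀ (z : ℂ) (x : LinearMap.ker (e C : X →ₗ[ℂ] X)),
      (((algebraMap ℂ (LinearMap.ker (e C : X →ₗ[ℂ] X) →L[ℂ]
        LinearMap.ker (e C : X →ₗ[ℂ] X)) z - T.restrict hX) x :
        LinearMap.ker (e C : X →ₗ[ℂ] X)) : X) = (algebraMap ℂ (X →L[ℂ] X) z - T) x :=
    fun z x => rfl
  ext z
  rw [← not_iff_not, spectrum.notMem_iff, ContinuousLinearMap.isUnit_iff_bijective]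
  constructor
  · rintro ⟨hinj, hsurj⟩ ⟨hz, hzC⟩
    obtain ⟨V, hVe, hV1, hV2⟩ := he.exists_inverse hC hzC
    refine hz (ContinuousLinearMap.isUnit_iff_bijective.2 ⟨?_, ?_⟩)
    · rw [injective_iff_map_eq_zero]
      intro x hx
      have hxe : e C x = 0 := by
        rw [← hV1]
        change V ((algebraMap ℂ (X →L[ℂ] X) z - T) x) = 0
        rw [hx, map_zero]
      have h0 := (injective_iff_map_eq_zero _).1 hinj ⟨x, hxe⟩ (Subtype.ext hx)
      exact congrArg Subtype.val h0
    · intro y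
      have hmem : y - e C y ∈ LinearMap.ker (e C : X →ₗ[ℂ] X) := by
        have h1 : e C (e C y) = e C y := DFunLike.congr_fun (he.isIdempotentElem hC).eq y
        change e C (y - e C y) = 0
        rw [map_sub, h1, sub_self]
      obtain ⟨x, hx⟩ := hsurj ⟨_, hmem⟩
      -- The vector x solves the equation for the kernel component y - e C y, and V y solves it for
      -- e C y.
      refine ⟨x + V y, ?_⟩
      have h1 := congrArg Subtype.val hx
      rw [hval] at h1
      have h2 : (algebraMap ℂ (X →L[ℂ] X) z - T) (V y) = e C y := DFunLike.congr_fun hV2 y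
      rw [map_add, h1, h2]
      exact sub_add_cancel _ _
  · intro hz
    -- On the kernel the complementary idempotent 1 - e C is the identity, so this V inverts z - T
    -- there.
    obtain ⟨V, hVe, hV1, hV2⟩ := he.exists_inverse hC.compl hz
    rw [he.compl hC] at hVe hV1 hV2
    have hfix : ∀ x ∈ LinearMap.ker (e C : X →ₗ[ℂ] X), (1 - e C) x = x := fun x hx => by
      have hx' : e C x = 0 := hx
      simp [hx']
    constructor
    · rw [injective_iff_map_eq_zero]
      intro x hx
      have h1 := congrArg Subtype.val hx
      rw [hval] at h1
      have h2 : V ((algebraMap ℂ (X →L[ℂ] X) z - T) x.1) = (1 - e C) x.1 :=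
        DFunLike.congr_fun hV1 x.1
      rw [hfix x x.2, h1] at h2
      exact Subtype.ext (h2.symm.trans (map_zero V))
    · intro y
      have hmem : V y ∈ LinearMap.ker (e C : X →ₗ[ℂ] X) := by
        have h1 : V ((1 - e C) y.1) = (1 - e C) (V y.1) := DFunLike.congr_fun hVe.eq y.1
        rw [hfix y y.2] at h1
        change e C (V y) = 0
        rw [h1]
        have h2 : e C (e C (V y)) = e C (V y) :=
          DFunLike.congr_fun (he.isIdempotentElem hC).eq (V y)
        change e C (V y - e C (V y)) = 0
        rw [map_sub, h2, sub_self]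
      refine ⟨⟨V y, hmem⟩, Subtype.ext ?_⟩
      rw [hval]
      exact (DFunLike.congr_fun hV2 y.1).trans (hfix y y.2)

theorem IsRieszFamily.range_union_le (he : IsRieszFamily T e) {C D : Set ℂ}
    (hC : IsSpectralPart T C) (hD : IsSpectralPart T D) (hCD : Disjoint C D) :
    LinearMap.range (e (C ∪ D) : X →ₗ[ℂ] X) ≤
      LinearMap.range (e C : X →ₗ[ℂ] X) ⊔ LinearMap.range (e D : X →ₗ[ℂ] X) := by
  rintro _ ⟨x, rfl⟩
  rw [he.union hC hD hCD]
  exact Submodule.add_mem_sup ⟨x, rfl⟩ ⟨x, rfl⟩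

theorem IsRieszFamily.range_le_union (he : IsRieszFamily T e) {C D : Set ℂ}
    (hC : IsSpectralPart T C) (hD : IsSpectralPart T D) (hCD : Disjoint C D) :
    LinearMap.range (e C : X →ₗ[ℂ] X) ≤ LinearMap.range (e (C ∪ D) : X →ₗ[ℂ] X) := by
  rintro _ ⟨x, rfl⟩
  refine ⟨e C x, ?_⟩
  have h1 : e C (e C x) = e C x := DFunLike.congr_fun (he.isIdempotentElem hC).eq x
  have h2 : e D (e C x) = 0 := DFunLike.congr_fun (he.mul_eq_zero hD hC hCD.symm) x
  rw [he.union hC hD hCD]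
  change e C (e C x) + e D (e C x) = e C x
  rw [h1, h2, add_zero]

/-- If the two ranges agreed, the range of e D would lie in that of e C, and e C * e D = 0 would
give e D = 0. -/
theorem IsRieszFamily.finrank_lt_union (he : IsRieszFamily T e) {C D : Set ℂ}
    (hC : IsSpectralPart T C) (hD : IsSpectralPart T D) (hCD : Disjoint C D) (hD0 : D.Nonempty)
    (hfin : FiniteDimensional ℂ (LinearMap.range (e (C ∪ D) : X →ₗ[ℂ] X))) :
    Module.finrank ℂ (LinearMap.range (e C : X →ₗ[ℂ] X)) <
      Module.finrank ℂ (LinearMap.range (e (C ∪ D) : X →ₗ[ℂ] X)) := by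
  refine Submodule.finrank_lt_finrank_of_lt ((he.range_le_union hC hD hCD).lt_of_ne fun h => ?_)
  refine he.ne_zero hD hD0 (ContinuousLinearMap.ext fun x => ?_)
  have hle := he.range_le_union hD hC hCD.symm
  rw [Set.union_comm, ← h] at hle
  obtain ⟨y, hy⟩ := hle ⟨x, rfl⟩
  have hy' : e C y = e D x := hy
  have h1 : e C (e C y) = e C y := DFunLike.congr_fun (he.isIdempotentElem hC).eq y
  have h2 : e C (e D x) = 0 := DFunLike.congr_fun (he.mul_eq_zero hC hD hCD) x
  rw [hy', h2] at h1
  exact h1.symm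

theorem disjoint_of_norm_lt {C D : Set ℂ} {r : ℝ} (hC : ∀ z ∈ C, ‖z‖ < r)
    (hD : ∀ z ∈ D, r < ‖z‖) : Disjoint C D :=
  Set.disjoint_left.2 fun z h1 h2 => (hC z h1).not_gt (hD z h2)

theorem IsSpectralPart.of_sdiff {E C : Set ℂ} (hE : IsSpectralPart T E)
    (hC : C ⊆ spectrum ℂ T \ E) (hC1 : IsClosed C) (hC2 : IsClosed ((spectrum ℂ T \ E) \ C)) :
    IsSpectralPart T C := by
  refine ⟨hC.trans Set.sdiff_subset, hC1, ?_⟩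
  have : spectrum ℂ T \ C = E ∪ ((spectrum ℂ T \ E) \ C) := by
    ext z
    have h1 := @hE.1 z
    have h2 := @hC z
    simp only [Set.mem_sdiff, Set.mem_union] at *
    tauto
  rw [this]
  exact hE.2.1.union hC2

/-- If any two spectral parts separated by a circle have total rank at most `n`, then some circle
meets all components of the spectrum, except for at most two finite-rank spectral parts. -/
theorem IsRieszFamily.exists_circle [CompleteSpace X] (he : IsRieszFamily T e) {n : ℕ}
    (hdim : ∀ {C D : Set ℂ} {r : ℝ}, IsSpectralPart T C → IsSpectralPart T D → C.Nonempty →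
      D.Nonempty → 0 < r → (∀ z ∈ C, ‖z‖ < r) → (∀ z ∈ D, r < ‖z‖) →
      FiniteDimensional ℂ (LinearMap.range (e C : X →ₗ[ℂ] X)) ∧
      FiniteDimensional ℂ (LinearMap.range (e D : X →ₗ[ℂ] X)) ∧
      Module.finrank ℂ (LinearMap.range (e C : X →ₗ[ℂ] X)) +
        Module.finrank ℂ (LinearMap.range (e D : X →ₗ[ℂ] X)) ≤ n) :
    ∃ E, IsSpectralPart T E ∧
      (∃ R : ℝ, 0 ≤ R ∧ ∀ z ∈ spectrum ℂ T \ E,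
        (Metric.sphere (0 : ℂ) R ∩ connectedComponentIn (spectrum ℂ T \ E) z).Nonempty) ∧
      (E = ∅ ∨ ∃ C D : Set ℂ, IsSpectralPart T C ∧ IsSpectralPart T D ∧ C.Nonempty ∧
        D.Nonempty ∧ Disjoint C D ∧ E = C ∪ D ∧
        FiniteDimensional ℂ (LinearMap.range (e C : X →ₗ[ℂ] X)) ∧
        FiniteDimensional ℂ (LinearMap.range (e D : X →ₗ[ℂ] X)) ∧
        Module.finrank ℂ (LinearMap.range (e C : X →ₗ[ℂ] X)) +
          Module.finrank ℂ (LinearMap.range (e D : X →ₗ[ℂ] X)) ≤ n) := by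
  have hσ : IsCompact (spectrum ℂ T) := spectrum.isCompact T
  by_cases hsep : ∃ (r : ℝ) (C D : Set ℂ), 0 < r ∧ IsSpectralPart T C ∧ IsSpectralPart T D ∧
      C.Nonempty ∧ D.Nonempty ∧ (∀ z ∈ C, ‖z‖ < r) ∧ ∀ z ∈ D, r < ‖z‖
  · obtain ⟨r, C₀, D₀, hr, h₀⟩ := hsep
    -- Total ranks of pairs separated by the fixed circle are bounded by n, so a maximal pair
    -- exists. A component missing the circle would give a part G that enlarges C or D and strictly
    -- raises the rank.
    let S : Set ℕ := {m | ∃ C D : Set ℂ, (IsSpectralPart T C ∧ IsSpectralPart T D ∧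
      C.Nonempty ∧ D.Nonempty ∧ (∀ z ∈ C, ‖z‖ < r) ∧ ∀ z ∈ D, r < ‖z‖) ∧
      Module.finrank ℂ (LinearMap.range (e C : X →ₗ[ℂ] X)) +
        Module.finrank ℂ (LinearMap.range (e D : X →ₗ[ℂ] X)) = m}
    have hSb : BddAbove S := by
      refine ⟨n, ?_⟩
      rintro _ ⟨C, D, ⟨hC, hD, hC0, hD0, hCr, hDr⟩, rfl⟩
      exact (hdim hC hD hC0 hD0 hr hCr hDr).2.2
    obtain ⟨C, D, ⟨hC, hD, hC0, hD0, hCr, hDr⟩, hmax⟩ :=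
      Nat.sSup_mem (s := S) ⟨_, C₀, D₀, h₀, rfl⟩ hSb
    have hle : ∀ {C' D' : Set ℂ}, (IsSpectralPart T C' ∧ IsSpectralPart T D' ∧
        C'.Nonempty ∧ D'.Nonempty ∧ (∀ z ∈ C', ‖z‖ < r) ∧ ∀ z ∈ D', r < ‖z‖) →
        Module.finrank ℂ (LinearMap.range (e C' : X →ₗ[ℂ] X)) +
          Module.finrank ℂ (LinearMap.range (e D' : X →ₗ[ℂ] X)) ≤
        Module.finrank ℂ (LinearMap.range (e C : X →ₗ[ℂ] X)) +
          Module.finrank ℂ (LinearMap.range (e D : X →ₗ[ℂ] X)) := by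
      intro C' D' h
      rw [hmax]
      exact le_csSup hSb ⟨C', D', h, rfl⟩
    refine ⟨C ∪ D, hC.union hD, ⟨r, hr.le, fun z hz => ?_⟩, Or.inr ⟨C, D, hC, hD, hC0, hD0,
      disjoint_of_norm_lt hCr hDr, rfl, hdim hC hD hC0 hD0 hr hCr hDr⟩⟩
    by_contra hmiss
    obtain ⟨G, hG, hzG, hG1, hG2, hGr⟩ := exists_isClosed_subset_of_sphere_inter_eq_empty
      (hσ.of_isClosed_subset (hC.union hD).2.2 Set.sdiff_subset) hz hmiss
    have hGp := (hC.union hD).of_sdiff hG hG1 hG2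
    have hCG : Disjoint C G := Set.disjoint_left.2 fun w h1 h2 => (hG h2).2 (Or.inl h1)
    have hDG : Disjoint D G := Set.disjoint_left.2 fun w h1 h2 => (hG h2).2 (Or.inr h1)
    rcases hGr with hGr | hGr
    · have hr' : ∀ z ∈ C ∪ G, ‖z‖ < r := fun z hz => hz.elim (hCr z) (hGr z)
      have h1 := he.finrank_lt_union hC hGp hCG ⟨z, hzG⟩
        (hdim (hC.union hGp) hD hC0.inl hD0 hr hr' hDr).1
      have h2 := hle ⟨hC.union hGp, hD, hC0.inl, hD0, hr', hDr⟩
      omega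
    · have hr' : ∀ z ∈ D ∪ G, r < ‖z‖ := fun z hz => hz.elim (hDr z) (hGr z)
      have h1 := he.finrank_lt_union hD hGp hDG ⟨z, hzG⟩
        (hdim hC (hD.union hGp) hC0 hD0.inl hr hCr hr').2.1
      have h2 := hle ⟨hC, hD.union hGp, hC0, hD0.inl, hCr, hr'⟩
      omega
  · let S : Set ℝ := {r | r = 0 ∨ 0 ≤ r ∧ ∃ D, IsSpectralPart T D ∧ D.Nonempty ∧
      ∀ z ∈ D, r < ‖z‖}
    have hSb : BddAbove S := by
      obtain ⟨B, hB⟩ := hσ.isBounded.exists_norm_le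
      refine ⟨max B 0, ?_⟩
      rintro r (rfl | ⟨-, D, hD, ⟨z, hz⟩, hDr⟩)
      · exact le_max_right _ _
      · exact ((hDr z hz).le.trans (hB z (hD.1 hz))).trans (le_max_left _ _)
    have hR0 : 0 ≤ sSup S := le_csSup hSb (Or.inl rfl)
    refine ⟨∅, .empty T, ⟨sSup S, hR0, ?_⟩, Or.inl rfl⟩
    rw [Set.sdiff_empty]
    intro z hz
    by_contra hmiss
    obtain ⟨G, hG, hzG, hG1, hG2, hGr⟩ :=
      exists_isClosed_subset_of_sphere_inter_eq_empty hσ hz hmiss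
    have hGc : IsCompact G := hσ.of_isClosed_subset hG1 hG
    rcases hGr with hGr | hGr
    -- A part G inside the circle has maximal modulus below the supremum, so some r in S separates
    -- it from a part D, against `hsep`.
    · obtain ⟨w, hw, hwmax⟩ := hGc.exists_isMaxOn ⟨z, hzG⟩ continuous_norm.continuousOn
      obtain ⟨r, hr, hwr⟩ := exists_lt_of_lt_csSup (s := S) ⟨0, Or.inl rfl⟩ (hGr w hw)
      rcases hr with rfl | ⟨-, D, hD, hD0, hDr⟩
      · exact (norm_nonneg w).not_gt hwr
      · exact hsep ⟨r, G, D, (norm_nonneg w).trans_lt hwr, ⟨hG, hG1, hG2⟩, hD, ⟨z, hzG⟩, hD0,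
          fun y hy => (hwmax hy).trans_lt hwr, hDr⟩
    -- A part outside the circle puts a radius larger than the supremum into S.
    · obtain ⟨w, hw, hwmin⟩ := hGc.exists_isMinOn ⟨z, hzG⟩ continuous_norm.continuousOn
      obtain ⟨r, hr, hrw⟩ := exists_between (hGr w hw)
      have hmem : r ∈ S := Or.inr ⟨hR0.trans hr.le, G, ⟨hG, hG1, hG2⟩, ⟨z, hzG⟩,
        fun y hy => hrw.trans_le (hwmin hy)⟩
      exact (le_csSup hSb hmem).not_gt hr

theorem exists_eigenvector_of_finrank_range_eq_one {P : X →L[ℂ] X} (hPP : IsIdempotentElem P)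
    (hPT : Commute P T) (h : Module.finrank ℂ (LinearMap.range (P : X →ₗ[ℂ] X)) = 1) :
    ∃ v, v ≠ 0 ∧ P v = v ∧ ∃ c : ℂ, T v = c • v := by
  obtain ⟨⟨v, x, hx⟩, hv, hspan⟩ := finrank_eq_one_iff'.1 h
  have hPv : P v = v := by
    rw [← hx]; exact DFunLike.congr_fun hPP.eq x
  have hTv : P (T v) = T v := by
    have h1 : P (T v) = T (P v) := DFunLike.congr_fun hPT.eq v
    rw [h1, hPv]
  obtain ⟨c, hc⟩ := hspan ⟨T v, T v, hTv⟩
  exact ⟨v, fun h0 => hv (Subtype.ext h0), hPv, c, (congrArg Subtype.val hc).symm⟩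

theorem IsDiagonalOperator.of_basis {V : Type*} [AddCommGroup V] [Module ℂ V] {f : V →ₗ[ℂ] V}
    {d : ℕ} (b : Module.Basis (Fin d) ℂ V) (h : ∀ i, ∃ c : ℂ, f (b i) = c • b i) :
    IsDiagonalOperator f := by
  refine ⟨d, b, fun i j hij => ?_⟩
  obtain ⟨c, hc⟩ := h j
  rw [LinearMap.toMatrix_apply, hc]
  simp [Ne.symm hij]

theorem isDiagonalOperator_restrict_of_eigenvectors {F : Submodule ℂ X} (hF : ∀ x ∈ F, T x ∈ F)
    [FiniteDimensional ℂ F] {d : ℕ} (hd : Module.finrank ℂ F ≤ d) {v : Fin d → X}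
    (hv : LinearIndependent ℂ v) (hvF : ∀ i, v i ∈ F) (hTv : ∀ i, ∃ c : ℂ, T (v i) = c • v i) :
    IsDiagonalOperator ((T : X →ₗ[ℂ] X).restrict hF) := by
  let w : Fin d → F := fun i => ⟨v i, hvF i⟩
  have hw : LinearIndependent ℂ w := LinearIndependent.of_comp F.subtype hv
  have hcard : Fintype.card (Fin d) = Module.finrank ℂ F :=
    le_antisymm hw.fintype_card_le_finrank (by rwa [Fintype.card_fin])
  -- The basis built from an independent family needs a nonempty index type, hence the separate case
  -- d = 0.
  have hne : d ≠ 0 ∨ d = 0 := (em _).symm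
  rcases hne with hd0 | rfl
  · have : Nonempty (Fin d) := ⟨⟨0, Nat.pos_of_ne_zero hd0⟩⟩
    refine .of_basis (basisOfLinearIndependentOfCardEqFinrank hw hcard) fun i => ?_
    obtain ⟨c, hc⟩ := hTv i
    refine ⟨c, ?_⟩
    rw [coe_basisOfLinearIndependentOfCardEqFinrank]
    exact Subtype.ext hc
  · exact .of_basis (Module.finBasisOfFinrankEq ℂ F hcard.symm) fun i => i.elim0

end Riesz

/-! ### The main theorem. -/

theorem IsStronglySupercyclic.nontrivial {X : Type*} [NormedAddCommGroup X] [NormedSpace ℂ X]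
    {n : ℕ} (hn : 1 ≤ n) {T : X →L[ℂ] X} (hT : IsStronglySupercyclic n T) : Nontrivial X := by
  obtain ⟨L, orbit, -⟩ := hT
  rw [← not_subsingleton_iff_nontrivial]
  intro h
  have h1 := (orbit 0).2.2
  rw [Module.finrank_zero_of_subsingleton] at h1
  omega

theorem theorem3p3 {X : Type*} [NormedAddCommGroup X] [NormedSpace ℂ X] [CompleteSpace X]
    (n : ℕ) (hn : 1 ≤ n) (T : X →L[ℂ] X) (hT : IsStronglySupercyclic n T) :
    ∃ (F X₀ : Submodule ℂ X) (hF : ∀ x ∈ F, T x ∈ F) (hX₀ : ∀ x ∈ X₀, T x ∈ X₀),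
      IsClosed (X₀ : Set X) ∧ IsCompl F X₀ ∧
      FiniteDimensional ℂ F ∧ Module.finrank ℂ F ≤ n ∧
      (∃ R : ℝ, 0 ≤ R ∧ ∀ z ∈ spectrum ℂ (T.restrict hX₀ : X₀ →L[ℂ] X₀),
        (Metric.sphere (0 : ℂ) R ∩
          connectedComponentIn (spectrum ℂ (T.restrict hX₀ : X₀ →L[ℂ] X₀)) z).Nonempty) ∧
      (n = 2 → IsDiagonalOperator ((T : X →ₗ[ℂ] X).restrict hF)) := by
  have := hT.nontrivial hn
  obtain ⟨e, he⟩ := exists_isRieszFamily T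
  obtain ⟨E, hE, ⟨R, hR0, hR⟩, hEcases⟩ := he.exists_circle (n := n) (by
    intro C D r hC hD hC0 hD0 hr hCr hDr
    obtain ⟨α, β, hα, hβ, hαβ⟩ := he.exists_growth hC hD hr hCr hDr
    have hCD := disjoint_of_norm_lt hCr hDr
    exact hT.finrank_range_add_le hn (he.ne_zero hC hC0) (he.ne_zero hD hD0)
      (he.isIdempotentElem hC) (he.isIdempotentElem hD) (he.mul_eq_zero hC hD hCD)
      (he.mul_eq_zero hD hC hCD.symm) hr (he.commute hD) hα hβ hαβ)
  have hid := he.isIdempotentElem hE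
  have hfin : FiniteDimensional ℂ (LinearMap.range (e E : X →ₗ[ℂ] X)) ∧
      Module.finrank ℂ (LinearMap.range (e E : X →ₗ[ℂ] X)) ≤ n := by
    rcases hEcases with rfl | ⟨C, D, hC, hD, -, -, hCD, rfl, hCf, hDf, hle⟩
    · rw [he.empty_eq_zero]
      have h0 : LinearMap.range ((0 : X →L[ℂ] X) : X →ₗ[ℂ] X) = ⊥ := LinearMap.range_zero
      rw [h0, finrank_bot]
      exact ⟨inferInstance, Nat.zero_le _⟩
    · have h1 := he.range_union_le hC hD hCD
      exact ⟨Submodule.finiteDimensional_of_le h1, ((Submodule.finrank_mono h1).trans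
        (Submodule.finrank_add_le_finrank_add_finrank _ _)).trans hle⟩
  have := hfin.1
  refine ⟨LinearMap.range (e E : X →ₗ[ℂ] X), LinearMap.ker (e E : X →ₗ[ℂ] X),
    he.map_mem_range hE, he.map_mem_ker hE, isClosed_singleton.preimage (e E).continuous,
    LinearMap.IsIdempotentElem.isCompl (ContinuousLinearMap.IsIdempotentElem.toLinearMap hid),
    hfin.1, hfin.2, ?_, ?_⟩
  · rw [he.spectrum_restrict_ker hE]
    exact ⟨R, hR0, hR⟩
  · rintro rfl
    rcases hEcases with rfl | ⟨C, D, hC, hD, hC0, hD0, hCD, rfl, hCf, hDf, hle⟩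
    · refine isDiagonalOperator_restrict_of_eigenvectors _ (d := 0) ?_ (v := Fin.elim0)
        (linearIndependent_empty_type) (fun i => i.elim0) fun i => i.elim0
      rw [he.empty_eq_zero]
      exact (congrArg (fun S : Submodule ℂ X => Module.finrank ℂ S)
        (LinearMap.range_zero : LinearMap.range (0 : X →ₗ[ℂ] X) = ⊥)).trans_le
          (finrank_bot ℂ X).le
    -- Both ranks are at least 1 and add up to at most 2, so each range is a line spanned by an
    -- eigenvector.
    · have hpos : ∀ {G : Set ℂ}, IsSpectralPart T G → G.Nonempty →
          FiniteDimensional ℂ (LinearMap.range (e G : X →ₗ[ℂ] X)) →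
          1 ≤ Module.finrank ℂ (LinearMap.range (e G : X →ₗ[ℂ] X)) := by
        intro G hG hG0 hGf
        rw [Nat.one_le_iff_ne_zero, Ne, Submodule.finrank_eq_zero, LinearMap.range_eq_bot]
        intro h0
        exact he.ne_zero hG hG0 (ContinuousLinearMap.ext fun x => DFunLike.congr_fun h0 x)
      have hC1 := hpos hC hC0 hCf
      have hD1 := hpos hD hD0 hDf
      obtain ⟨v, hv0, hPv, hTv⟩ := exists_eigenvector_of_finrank_range_eq_one
        (he.isIdempotentElem hC) (he.commute hC) (by omega)
      obtain ⟨w, hw0, hQw, hTw⟩ := exists_eigenvector_of_finrank_range_eq_one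
        (he.isIdempotentElem hD) (he.commute hD) (by omega)
      have hPw : e C w = 0 := by
        rw [← hQw]; exact DFunLike.congr_fun (he.mul_eq_zero hC hD hCD) w
      refine isDiagonalOperator_restrict_of_eigenvectors _ hfin.2 (v := ![v, w]) ?_ ?_ ?_
      · rw [LinearIndependent.pair_iff]
        intro s t hst
        have h1 := congrArg (e C) hst
        rw [map_add, map_smul, map_smul, hPv, hPw, smul_zero, add_zero, map_zero] at h1
        have hs : s = 0 := (smul_eq_zero.1 h1).resolve_right hv0
        rw [hs, zero_smul, zero_add] at hst
        exact ⟨hs, (smul_eq_zero.1 hst).resolve_right hw0⟩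
      · rw [Fin.forall_fin_two]
        refine ⟨he.range_le_union hC hD hCD ⟨v, hPv⟩, ?_⟩
        rw [Set.union_comm]
        exact he.range_le_union hD hC hCD.symm ⟨w, hQw⟩
      · rw [Fin.forall_fin_two]
        exact ⟨hTv, hTw⟩
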